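/- **Setting.** Let $S$ be a non-empty finite set, $S^\pm=S\sqcup S^{-1}$ the letters and their formal inverses, $F_S$ the free group on $S$; a word $w$ over $S^\pm$ is also read as an element of $F_S$. A $\mathrm{CAT}(0)$ cube complex is a simply connected cube complex in which the link of every $0$-cube is a flag simplicial complex; its dimension is the maximal dimension of its cubes, and group actions on it are by cubical automorphisms. A hyperplane is a connected component of the complex formed by the midcubes; the components of its complement are its halfspaces, and it separates two sets if these lie in distinct halfspaces. Two hyperplanes are parallel if they are disjoint. Let $F_S$ act on a $\mathrm{CAT}(0)$ cube complex $X$ with a basepoint $x\in X^0$. A hyperplane $H$ is visible if for some $s\in S^\pm$ it separates $x$ and $sx$, and no hyperplane separates $x$ and $H$. Let $\mathcal H$ be the set of visible hyperplanes. For $H\in\mathcal H$ let $\mathcal B(H)$ be the set of those $s\in S^\pm$ for which $x$ and $sx$ lie in different halfspaces of $H$. An automaton over $S^\pm$ is a finite directed graph $\Sigma=(V,E)$ with edges labeled by $S^\pm$ and a start vertex $\mathfrak s$; it accepts the words that label directed paths beginning at $\mathfrak s$. It is deterministically labeled if the outgoing edges at each vertex have distinct labels. It has $\lambda$-large growth if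 there is $K>0$ such that every directed path from $\mathfrak s$ of length at least $K$ terminates on a vertex with at least $\lambda|S^\pm|$ outgoing edges. It is progressing if there are a non-empty set $C\subset V-\{\mathfrak s\}$ and a map $H\colon C\to\mathcal H$ such that: 1. If $P$ is a directed path of positive length from $\mathfrak s$ with label $w$ that does not meet $C$, or meets $C$ only at its terminal vertex, then $wx\ne x$; and if the terminal vertex of $P$ is $c\in C$, then $wH(c)$ separates $x$ and $wx$. 2. If $P$ is a directed path with label $w$ and initial vertex $c_1\in C$ that meets $C$ only at its initial vertex, or only at its initial and terminal vertices, then $x$ and $wx$ lie in the same halfspace of $H(c_1)$; and if the terminal vertex of $P$ is $c_2\in C$, then either $wH(c_2)=H(c_1)$, or $wH(c_2)$ is parallel to $H(c_1)$ and separates $x$ and $wx$. **Theorem.** There is a function $\theta$, with $\theta(n,\epsilon_1)\in(0,1]$ for all integers $n\ge 0$ and all $\epsilon_1\in(0,1)$, such that the following holds for all such $n$ and $\epsilon_1$. Let $S$ be a non-empty finite set, let $F_S$ act on an $n$-dimensional $\mathrm{CAT}(0)$ cube complex $X$, and let $x\in X^0$ be a $0$-cube with $sx\neq x$ for every $s\in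 S^\pm$. Suppose that $|\mathcal B(H)|\le\epsilon_1|S^\pm|$ for every $H\in\mathcal H$. Then there is a deterministically labeled progressing automaton $\Sigma$ over $S^\pm$ with at most $(|S^\pm|n+1)^n$ vertices and $\theta(n,\epsilon_1)$-large growth, in which every directed path beginning at $\mathfrak s$ can be prolonged by an edge. Moreover, every non-empty word $w$ accepted by $\Sigma$ satisfies $wx\ne x$. -/

import Mathlib

universe u v

/-! ### Cubes and cube complexes -/

/-- A combinatorial isomorphism of the `m`-cube onto an `m`-dimensional face of the `n`-cube.
The corners of the `n`-cube `[-1,1]^n` are the functions `Fin n → Bool`. The map sends the corner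
`origin` to `base`, and the `i`-th coordinate of the `m`-cube runs along the coordinate `dir i` of
the `n`-cube; the coordinates of the `n`-cube outside the range of `dir` are constant.
For `m = n` these are the symmetries of the cube. -/
@[ext]
structure FaceMap (m n : ℕ) where
  dir : Fin m ↪ Fin n
  base : Fin n → Bool

namespace FaceMap

variable {k l m n : ℕ}

/-- The corner of the `n`-cube that a face map assigns to a corner of the `m`-cube. -/
def apply (φ : FaceMap m n) (a : Fin m → Bool) : Fin n → Bool :=
  fun j => xor (φ.base j) (decide (∃ i, φ.dir i = j ∧ a i = true))

/-- The identity of the `n`-cube. -/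
def id (n : ℕ) : FaceMap n n := ⟨Function.Embedding.refl _, fun _ => false⟩

/-- Composition of face maps: first `ψ`, then `φ`. -/
def comp (φ : FaceMap m n) (ψ : FaceMap l m) : FaceMap l n :=
  ⟨ψ.dir.trans φ.dir, φ.apply ψ.base⟩

theorem apply_comp (φ : FaceMap m n) (ψ : FaceMap l m) (a : Fin l → Bool) :
    (φ.comp ψ).apply a = φ.apply (ψ.apply a) := by
  funext j
  by_cases h : ∃ i, φ.dir i = j
  · obtain ⟨i, rfl⟩ := h
    have h1 : ∀ p : Fin m → Prop, (∃ i', i' = i ∧ p i') ↔ p i := fun p => by simp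
    simp only [apply, comp, Function.Embedding.trans_apply, φ.dir.injective.eq_iff, h1]
    cases φ.base (φ.dir i) <;> cases ψ.base i <;>
      cases h2 : decide (∃ i', ψ.dir i' = i ∧ a i' = true) <;> rfl
  · push Not at h
    simp [apply, comp, h]

/-- The inclusion of the `0`-cube as the corner `v`. -/
def corner (v : Fin n → Bool) : FaceMap 0 n := ⟨⟨Fin.elim0, fun i => i.elim0⟩, v⟩

/-- The inclusion of the `1`-cube as the edge that leaves the corner `v` in direction `i`. -/
def edge (v : Fin n → Bool) (i : Fin n) : FaceMap 1 n :=
  ⟨⟨fun _ => i, fun _ _ _ => Subsingleton.elim _ _⟩, v⟩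

end FaceMap

/-- A cube complex: cubes glued along faces by combinatorial isomorphisms. `Cube n` is the set of
parametrized `n`-cubes (the characteristic maps `[-1,1]^n → X`, each `n`-cell being counted once
for every symmetry of the `n`-cube), and `face φ c` is the parametrized cube `c ∘ φ`.
Thus `Cube 0` is the set of `0`-cubes and `Cube 1` is the set of oriented `1`-cubes.
The condition `free` says that no cube is glued to itself by a non-trivial symmetry. -/
structure CubeComplex where
  Cube : ℕ → Type v
  face : ∀ {m n : ℕ}, FaceMap m n → Cube n → Cube m
  face_id : ∀ {n : ℕ} (c : Cube n), face (FaceMap.id n) c = c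
  face_comp : ∀ {l m n : ℕ} (φ : FaceMap m n) (ψ : FaceMap l m) (c : Cube n),
    face (φ.comp ψ) c = face ψ (face φ c)
  free : ∀ {n : ℕ} (σ : FaceMap n n) (c : Cube n), face σ c = c → σ = FaceMap.id n

/-- `IsEdgePath src tgt x l y`: the list `l` of directed edges is a directed path from `x` to `y`. -/
def IsEdgePath {V E : Type*} (src tgt : E → V) : V → List E → V → Prop
  | x, [], y => x = y
  | x, e :: l, y => src e = x ∧ IsEdgePath src tgt (tgt e) l y

namespace CubeComplex

variable (X : CubeComplex.{v})

/-- The `0`-cube of `X` at the corner `a` of the cube `c`. -/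
def vertex {n : ℕ} (c : X.Cube n) (a : Fin n → Bool) : X.Cube 0 := X.face (FaceMap.corner a) c

/-- The oriented `1`-cube of `X` that leaves the corner `a` of the cube `c` in direction `i`. -/
def edge {n : ℕ} (c : X.Cube n) (a : Fin n → Bool) (i : Fin n) : X.Cube 1 :=
  X.face (FaceMap.edge a i) c

/-- The initial vertex of an oriented `1`-cube. -/
def src (e : X.Cube 1) : X.Cube 0 := X.vertex e (fun _ => false)

/-- The terminal vertex of an oriented `1`-cube. -/
def tgt (e : X.Cube 1) : X.Cube 0 := X.vertex e (fun _ => true)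

/-- The same `1`-cube with the opposite orientation. -/
def rev (e : X.Cube 1) : X.Cube 1 := X.edge e (fun _ => true) 0

/-- `l` is a path from `x` to `y` in the `1`-skeleton. -/
def IsPath (x : X.Cube 0) (l : List (X.Cube 1)) (y : X.Cube 0) : Prop :=
  IsEdgePath X.src X.tgt x l y

/-- The links of all `0`-cubes are flag simplicial complexes. An `(n-1)`-simplex of the link of `x`
is a corner at `x` of an `n`-cube, that is, up to a permutation of the coordinates, a parametrized
cube `c` whose corner `origin` is at `x`; its vertices are the `n` edges of `c` at this corner. -/
structure NonpositivelyCurved : Prop where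
  /-- The vertices of a simplex of a link are distinct. -/
  link_injective : ∀ {n : ℕ} (c : X.Cube n),
    Function.Injective fun i => X.edge c (fun _ => false) i
  /-- A simplex of a link is determined by its vertices. -/
  link_unique : ∀ {n : ℕ} (c c' : X.Cube n),
    X.vertex c (fun _ => false) = X.vertex c' (fun _ => false) →
    (∀ i, X.edge c (fun _ => false) i = X.edge c' (fun _ => false) i) → c = c'
  /-- Pairwise adjacent vertices of a link span a simplex. -/
  link_flag : ∀ {n : ℕ} (x : X.Cube 0) (e : Fin n → X.Cube 1), Function.Injective e →
    (∀ i, X.src (e i) = x) →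
    (∀ i j, i ≠ j → ∃ c : X.Cube 2,
      X.edge c (fun _ => false) 0 = e i ∧ X.edge c (fun _ => false) 1 = e j) →
    ∃ c : X.Cube n, X.vertex c (fun _ => false) = x ∧ ∀ i, X.edge c (fun _ => false) i = e i

/-- An elementary homotopy of edge paths: removing a backtrack, or pushing across a square. -/
inductive Elementary : List (X.Cube 1) → List (X.Cube 1) → Prop
  | backtrack (p q : List (X.Cube 1)) (e : X.Cube 1) :
      Elementary (p ++ [e, X.rev e] ++ q) (p ++ q)
  | square (p q : List (X.Cube 1)) (c : X.Cube 2) :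
      Elementary
        (p ++ [X.edge c ![false, false] 0, X.edge c ![true, false] 1] ++ q)
        (p ++ [X.edge c ![false, false] 1, X.edge c ![false, true] 0] ++ q)

/-- Homotopy of edge paths from `x` to `y`, relative to the endpoints. -/
def Homotopic (x y : X.Cube 0) : List (X.Cube 1) → List (X.Cube 1) → Prop :=
  Relation.EqvGen fun p q => X.IsPath x p y ∧ X.IsPath x q y ∧ X.Elementary p q

/-- `X` is non-empty, connected, and its edge-path fundamental group is trivial. -/
structure SimplyConnected : Prop where
  nonempty : Nonempty (X.Cube 0)
  connected : ∀ x y : X.Cube 0, ∃ l, X.IsPath x l y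
  contractible : ∀ (x : X.Cube 0) (l : List (X.Cube 1)), X.IsPath x l x → X.Homotopic x x l []

/-- A `CAT(0)` cube complex: simply connected and non-positively curved. -/
structure IsCAT0 : Prop where
  simplyConnected : X.SimplyConnected
  nonpositivelyCurved : X.NonpositivelyCurved

/-- `X` has dimension `n`: the maximal dimension of a cube of `X` is `n`. -/
def HasDim (n : ℕ) : Prop := Nonempty (X.Cube n) ∧ ∀ m, n < m → IsEmpty (X.Cube m)

/-! ### Hyperplanes -/

/-- The midpoints of two `1`-cubes coincide, or are joined by a midcube of a square. -/
inductive MidcubeAdj : X.Cube 1 → X.Cube 1 → Prop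
  | rev (e : X.Cube 1) : MidcubeAdj e (X.rev e)
  | opposite (c : X.Cube 2) :
      MidcubeAdj (X.edge c ![false, false] 0) (X.edge c ![false, true] 0)

/-- A hyperplane, a connected component of the complex of midcubes, given as the set of the
`1`-cubes that are dual to it: an equivalence class for the equivalence relation generated by
reversal and by being opposite in a square. -/
def Hyperplane : Type v := Quot X.MidcubeAdj

/-- The hyperplane dual to a `1`-cube, i.e. through its midpoint. -/
def dual (e : X.Cube 1) : X.Hyperplane := Quot.mk _ e

variable {X}

/-- The `0`-cubes `x`, `y` lie in the same component (halfspace) of the complement of `H`: they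
are joined by an edge path that does not meet `H`. -/
def SameHalfspace (H : X.Hyperplane) (x y : X.Cube 0) : Prop :=
  ∃ l, X.IsPath x l y ∧ ∀ e ∈ l, X.dual e ≠ H

/-- `H` separates the `0`-cubes `x` and `y`: they lie in distinct halfspaces of `H`. -/
def Separates (H : X.Hyperplane) (x y : X.Cube 0) : Prop := ¬ SameHalfspace H x y

/-- `H'` separates the `0`-cube `x` from the hyperplane `H`: all `1`-cubes dual to `H` lie in
halfspaces of `H'` that do not contain `x`. (Both ends are covered, as both orientations occur.) -/
def SeparatesFromHyperplane (H' : X.Hyperplane) (x : X.Cube 0) (H : X.Hyperplane) : Prop :=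
  ∀ e, X.dual e = H → Separates H' x (X.src e)

/-- `H` is closest to `x`: no hyperplane separates `x` and `H`. -/
def IsClosest (x : X.Cube 0) (H : X.Hyperplane) : Prop :=
  ¬ ∃ H' : X.Hyperplane, SeparatesFromHyperplane H' x H

/-- Distinct hyperplanes cross if they intersect: two midcubes of some square lie in them. -/
def Crosses (H H' : X.Hyperplane) : Prop :=
  H ≠ H' ∧ ∃ c : X.Cube 2, X.dual (X.edge c ![false, false] 0) = H ∧
    X.dual (X.edge c ![false, false] 1) = H'

/-- Hyperplanes are parallel if they are disjoint. -/
def Parallel (H H' : X.Hyperplane) : Prop := H ≠ H' ∧ ¬ Crosses H H'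

end CubeComplex

/-! ### Actions -/

/-- An action of `G` on the cube complex `X` by automorphisms. -/
class CubicalAction (G : Type u) [Group G] (X : CubeComplex.{v}) where
  mulAction : ∀ n : ℕ, MulAction G (X.Cube n)
  face_smul : ∀ {m n : ℕ} (φ : FaceMap m n) (g : G) (c : X.Cube n),
    X.face φ (g • c) = g • X.face φ c

attribute [reducible, instance] CubicalAction.mulAction

/-- The action on hyperplanes. -/
instance CubicalAction.smulHyperplane (G : Type u) [Group G] (X : CubeComplex.{v})
    [CubicalAction G X] : SMul G X.Hyperplane where
  smul g := Quot.map (fun e => g • e) (by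
    intro e e' h
    cases h with
    | rev e =>
      have h1 : g • X.rev e = X.rev (g • e) := (CubicalAction.face_smul _ g e).symm
      rw [h1]
      exact .rev _
    | opposite c =>
      have h1 : ∀ a i, g • X.edge c a i = X.edge (g • c) a i :=
        fun a i => (CubicalAction.face_smul _ g c).symm
      rw [h1, h1]
      exact .opposite _)

/-! ### Generators and visible hyperplanes

The letters of `S^±` are the pairs `(s, true)`, standing for `s`, and `(s, false)`, standing for
`s⁻¹`; words over `S^±` are lists of letters, and `FreeGroup.mk w` is the element of the free group
that is represented by the word `w`. -/

section

variable {S : Type u} {X : CubeComplex.{v}} [CubicalAction (FreeGroup S) X]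

/-- The hyperplane `H` is visible: for some `s ∈ S^±` it separates `x` and `s x`, and it is
closest to `x`. -/
def VisibleHyperplane (x : X.Cube 0) (H : X.Hyperplane) : Prop :=
  ∃ s : S × Bool, CubeComplex.Separates H x (FreeGroup.mk [s] • x) ∧ CubeComplex.IsClosest x H

/-- The backward elements `B(H)`: those `s ∈ S^±` such that `x` and `s x` lie in different
halfspaces of `H`. -/
def backward (x : X.Cube 0) (H : X.Hyperplane) : Set (S × Bool) :=
  {s | CubeComplex.Separates H x (FreeGroup.mk [s] • x)}

end

/-! ### Automata -/

/-- A finite state automaton over the alphabet `A`: a finite directed graph (loops and multiple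
edges are allowed) with edges labeled by `A` and a start vertex. -/
structure Automaton (A : Type u) where
  V : Type
  E : Type
  finite_V : Finite V
  finite_E : Finite E
  src : E → V
  tgt : E → V
  label : E → A
  start : V

namespace Automaton

variable {A : Type u} (M : Automaton A)

/-- `l` is a directed path from `p` to `q`. -/
def IsPath (p : M.V) (l : List M.E) (q : M.V) : Prop := IsEdgePath M.src M.tgt p l q

/-- The label of a path. -/
def word (l : List M.E) : List A := l.map M.label

/-- The accepted language: the labels of the directed paths beginning at the start vertex. -/
def language : Language A := {w | ∃ l q, M.IsPath M.start l q ∧ M.word l = w}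

/-- The outgoing edges at each vertex have distinct labels. -/
def Deterministic : Prop := ∀ e f : M.E, M.src e = M.src f → M.label e = M.label f → e = f

/-- There are at least `r |A|` outgoing edges at the vertex `q`. -/
def LargeAt (r : ℝ) (q : M.V) : Prop :=
  r * (Nat.card A : ℝ) ≤ (({e : M.E | M.src e = q}.ncard : ℕ) : ℝ)

/-- The automaton has `r`-large growth: for some `K > 0`, each directed path from the start vertex
of length at least `K` terminates on a vertex with `r`-large growth. -/
def LargeGrowth (r : ℝ) : Prop :=
  ∃ K : ℕ, 0 < K ∧ ∀ l q, M.IsPath M.start l q → K ≤ l.length → M.LargeAt r q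

/-- Each directed path from the start vertex can be prolonged by an edge. (It makes large growth
a condition on actual paths: without it an automaton without long paths has large growth.) -/
def NoDeadEnds : Prop := ∀ l q, M.IsPath M.start l q → ∃ e, M.src e = q

end Automaton

/-- The automaton `M` over `S^±` is progressing, relative to the basepoint `x`. The vertices met by
a path `l` before its terminal vertex are the initial vertices of the edges in `l`. In the first
condition the path is non-trivial, as the empty word fixes `x`. -/
def Automaton.IsProgressing {S : Type u} {X : CubeComplex.{v}} [CubicalAction (FreeGroup S) X]
    (M : Automaton (S × Bool)) (x : X.Cube 0) : Prop :=
  ∃ (C : Set M.V) (H : M.V → X.Hyperplane),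
    C.Nonempty ∧ M.start ∉ C ∧ (∀ c ∈ C, VisibleHyperplane (S := S) x (H c)) ∧
    (∀ l q, l ≠ [] → M.IsPath M.start l q → (∀ e ∈ l, M.src e ∉ C) →
      FreeGroup.mk (M.word l) • x ≠ x ∧
      (q ∈ C → CubeComplex.Separates (FreeGroup.mk (M.word l) • H q) x
        (FreeGroup.mk (M.word l) • x))) ∧
    (∀ c ∈ C, ∀ l q, M.IsPath c l q → (∀ e ∈ l.tail, M.src e ∉ C) →
      CubeComplex.SameHalfspace (H c) x (FreeGroup.mk (M.word l) • x) ∧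
      (q ∈ C →
        FreeGroup.mk (M.word l) • H q = H c ∨
        (CubeComplex.Parallel (FreeGroup.mk (M.word l) • H q) (H c) ∧
          CubeComplex.Separates (FreeGroup.mk (M.word l) • H q) x
            (FreeGroup.mk (M.word l) • x))))

/-! The automaton follows a hyperplane `J` adjacent to `x`. It reads letters `t` for which `x` and
`tx` lie on one side of `J`. If `tx` is still adjacent to `J`, the next state is `t⁻¹J`. Otherwise
`exists_parallel_of_not_adj` gives a hyperplane parallel to `J`, adjacent to `tx` and separating `x`
from `tx`; its `t⁻¹`-translate is visible and becomes the next state. By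
`Parallel.separates_of_separates` the new hyperplane lies beyond the old one, so for a non-empty
word `w` leading to state `K`, `wK` separates `x` from `wx`, and `wx ≠ x`.

The difficulty is to have many letters at every state. Two arguments use that at most `n` pairwise
crossing hyperplanes are adjacent to a `0`-cube. First, if few letters cross a visible `H` and few
leave it, then the initial hyperplanes of almost all letters cross `H`; discarding the remaining
letters and repeating builds a crossing family, so this stops within `n` rounds. In the surviving
alphabet every visible hyperplane is crossed or left by a definite proportion of letters
(`exists_alphabet`). Second, a visible `H` with too few continuations would yield ever larger
crossing families of translates of `H`, up to `n + 1` members (`isGood_of_mem_visibleBy`). Hence at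
most `n` levels of translates of visible hyperplanes are needed as states, which bounds their
number.

The geometry rests on a normal form: reduced edge paths with common endpoints differ by square moves
(`IsCAT0.flipEquiv`). Thus reduced paths cross each hyperplane at most once and detect separation,
and crossing hyperplanes adjacent to a `0`-cube span a square there. -/

/-! ### Faces, squares and the link condition. -/

namespace FaceMap

/-- The `2`-face of the `n`-cube at the corner `v` in the directions `i`, `j`. -/
def square {n : ℕ} (v : Fin n → Bool) (i j : Fin n) (h : i ≠ j) : FaceMap 2 n :=
  ⟨⟨![i, j], by
    intro a b hab
    fin_cases a <;> fin_cases b <;> simp_all [eq_comm]⟩, v⟩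

@[simp] theorem edge_dir {n : ℕ} (v : Fin n → Bool) (i : Fin n) (k : Fin 1) :
    (edge v i).dir k = i := rfl

@[simp] theorem edge_base {n : ℕ} (v : Fin n → Bool) (i : Fin n) : (edge v i).base = v := rfl

@[simp] theorem square_dir_zero {n : ℕ} (v : Fin n → Bool) (i j : Fin n) (h : i ≠ j) :
    (square v i j h).dir 0 = i := rfl

@[simp] theorem square_dir_one {n : ℕ} (v : Fin n → Bool) (i j : Fin n) (h : i ≠ j) :
    (square v i j h).dir 1 = j := rfl

@[simp] theorem square_base {n : ℕ} (v : Fin n → Bool) (i j : Fin n) (h : i ≠ j) :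
    (square v i j h).base = v := rfl

theorem comp_edge {m n : ℕ} (φ : FaceMap m n) (a : Fin m → Bool) (i : Fin m) :
    φ.comp (edge a i) = edge (φ.apply a) (φ.dir i) := by
  ext
  · rfl
  · rfl

theorem comp_corner {m n : ℕ} (φ : FaceMap m n) (a : Fin m → Bool) :
    φ.comp (corner a) = corner (φ.apply a) := by
  ext i
  · exact i.elim0
  · rfl

theorem apply_edge {n : ℕ} (v : Fin n → Bool) (i : Fin n) (b : Fin 1 → Bool) :
    (edge v i).apply b = Function.update v i (xor (v i) (b 0)) := by
  funext j
  by_cases h : j = i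
  · subst h; simp [apply]
  · simp [apply, h, Ne.symm h]

theorem apply_square {n : ℕ} (v : Fin n → Bool) (i j : Fin n) (h : i ≠ j) (b : Fin 2 → Bool) :
    (square v i j h).apply b =
      Function.update (Function.update v i (xor (v i) (b 0))) j (xor (v j) (b 1)) := by
  funext k
  by_cases hj : k = j
  · subst hj; simp [apply, Fin.exists_fin_two, h]
  · by_cases hi : k = i
    · subst hi; simp [apply, Fin.exists_fin_two, h, Ne.symm h]
    · simp [apply, Fin.exists_fin_two, hj, hi, Ne.symm hi, Ne.symm hj]

end FaceMap

namespace CubeComplex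

variable {X : CubeComplex.{v}}

theorem edge_face {m n : ℕ} (φ : FaceMap m n) (c : X.Cube n) (a : Fin m → Bool) (i : Fin m) :
    X.edge (X.face φ c) a i = X.edge c (φ.apply a) (φ.dir i) := by
  rw [edge, ← X.face_comp, FaceMap.comp_edge]; rfl

theorem vertex_face {m n : ℕ} (φ : FaceMap m n) (c : X.Cube n) (a : Fin m → Bool) :
    X.vertex (X.face φ c) a = X.vertex c (φ.apply a) := by
  rw [vertex, ← X.face_comp, FaceMap.comp_corner]; rfl

theorem src_edge {n : ℕ} (c : X.Cube n) (v : Fin n → Bool) (i : Fin n) :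
    X.src (X.edge c v i) = X.vertex c v := by
  rw [src, edge, vertex_face, FaceMap.apply_edge]; simp

theorem tgt_edge {n : ℕ} (c : X.Cube n) (v : Fin n → Bool) (i : Fin n) :
    X.tgt (X.edge c v i) = X.vertex c (Function.update v i (!v i)) := by
  rw [tgt, edge, vertex_face, FaceMap.apply_edge]; simp

theorem rev_edge {n : ℕ} (c : X.Cube n) (v : Fin n → Bool) (i : Fin n) :
    X.rev (X.edge c v i) = X.edge c (Function.update v i (!v i)) i := by
  rw [rev, edge, edge, ← edge, edge_face, FaceMap.apply_edge]
  simp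

theorem edge_self (e : X.Cube 1) : X.edge e (fun _ => false) 0 = e := by
  have : FaceMap.edge (fun _ : Fin 1 => false) 0 = FaceMap.id 1 := by
    ext i
    · simp [FaceMap.edge, FaceMap.id]
    · rfl
  rw [edge, this, X.face_id]

@[simp] theorem rev_rev (e : X.Cube 1) : X.rev (X.rev e) = e := by
  rw [show X.rev e = X.edge e (fun _ => true) 0 from rfl, rev_edge]
  convert edge_self e using 2
  funext i; fin_cases i; simp

@[simp] theorem src_rev (e : X.Cube 1) : X.src (X.rev e) = X.tgt e := by
  rw [rev, src_edge]; rfl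

@[simp] theorem tgt_rev (e : X.Cube 1) : X.tgt (X.rev e) = X.src e := by
  rw [← src_rev, rev_rev]

@[simp] theorem dual_rev (e : X.Cube 1) : X.dual (X.rev e) = X.dual e :=
  (Quot.sound (.rev e)).symm

theorem rev_injective : Function.Injective X.rev := fun a b h => by
  rw [← rev_rev a, h, rev_rev]

/-- The paths `e f` and `g h` of length two are the two ways round a square. -/
def Sq (e f g h : X.Cube 1) : Prop :=
  ∃ c : X.Cube 2, e = X.edge c ![false, false] 0 ∧ f = X.edge c ![true, false] 1 ∧
    g = X.edge c ![false, false] 1 ∧ h = X.edge c ![false, true] 0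

theorem sq_edge {n : ℕ} (c : X.Cube n) (v : Fin n → Bool) {i j : Fin n} (hij : i ≠ j) :
    Sq (X.edge c v i) (X.edge c (Function.update v i (!v i)) j)
      (X.edge c v j) (X.edge c (Function.update v j (!v j)) i) := by
  have h1 : ∀ b, Function.update (Function.update v i b) j (v j) = Function.update v i b := by
    intro b
    simp [Ne.symm hij]
  refine ⟨X.face (FaceMap.square v i j hij) c, ?_, ?_, ?_, ?_⟩ <;>
    rw [edge_face, FaceMap.apply_square] <;> simp [h1]

variable {e f g h : X.Cube 1}

theorem flip_false_false_zero :
    Function.update ![false, false] 0 (!(![false, false] : Fin 2 → Bool) 0) = ![true, false] := by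
  decide

theorem flip_false_false_one :
    Function.update ![false, false] 1 (!(![false, false] : Fin 2 → Bool) 1) = ![false, true] := by
  decide

theorem Sq.symm (s : Sq e f g h) : Sq g h e f := by
  obtain ⟨c, rfl, rfl, rfl, rfl⟩ := s
  have := sq_edge c ![false, false] (i := 1) (j := 0) (by decide)
  rwa [flip_false_false_zero, flip_false_false_one] at this

/-- The same square read from the end of `e`. Together with `Sq.symm` this generates all eight
symmetries of a square. -/
theorem Sq.reflect (s : Sq e f g h) : Sq (X.rev e) g f (X.rev h) := by
  obtain ⟨c, rfl, rfl, rfl, rfl⟩ := s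
  have := sq_edge c ![true, false] (i := 0) (j := 1) (by decide)
  rw [rev_edge, rev_edge]
  convert this using 2 <;> decide

theorem Sq.src_eq (s : Sq e f g h) : X.src e = X.src g := by
  obtain ⟨c, rfl, rfl, rfl, rfl⟩ := s
  rw [src_edge, src_edge]

theorem Sq.tgt_eq_src (s : Sq e f g h) : X.tgt e = X.src f := by
  obtain ⟨c, rfl, rfl, rfl, rfl⟩ := s
  rw [src_edge, tgt_edge, flip_false_false_zero]

theorem Sq.tgt_eq (s : Sq e f g h) : X.tgt f = X.tgt h := by
  have := s.reflect.symm.tgt_eq_src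
  rwa [src_rev] at this

theorem Sq.dual_eq (s : Sq e f g h) : X.dual e = X.dual h := by
  obtain ⟨c, rfl, rfl, rfl, rfl⟩ := s
  exact Quot.sound (.opposite c)

/-- The far corner of a square. -/
theorem Sq.opposite (s : Sq e f g h) : Sq (X.rev f) (X.rev e) (X.rev h) (X.rev g) := by
  exact s.reflect.symm.reflect

theorem NonpositivelyCurved.sq_ne (hX : X.NonpositivelyCurved) (s : Sq e f g h) : e ≠ g := by
  obtain ⟨c, rfl, rfl, rfl, rfl⟩ := s
  intro h
  have h0 : (![false, false] : Fin 2 → Bool) = fun _ => false := by decide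
  rw [h0] at h
  exact absurd (hX.link_injective c h) (by decide)

theorem NonpositivelyCurved.sq_unique (hX : X.NonpositivelyCurved) {f' h' : X.Cube 1}
    (s : Sq e f g h) (s' : Sq e f' g h') : f = f' ∧ h = h' := by
  have h0 : (![false, false] : Fin 2 → Bool) = fun _ => false := by decide
  obtain ⟨c, he, rfl, hg, rfl⟩ := s
  obtain ⟨c', he', rfl, hg', rfl⟩ := s'
  have : c = c' := by
    refine hX.link_unique c c' ?_ ?_
    · rw [← h0, ← src_edge c _ 0, ← src_edge c' _ 0, ← he, ← he']
    · intro i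
      rw [← h0]
      fin_cases i
      · exact he.symm.trans he'
      · exact hg.symm.trans hg'
  subst this
  exact ⟨rfl, rfl⟩

/-- A square is determined by two consecutive sides. -/
theorem NonpositivelyCurved.sq_unique_path (hX : X.NonpositivelyCurved) {g' h' : X.Cube 1}
    (s : Sq e f g h) (s' : Sq e f g' h') : g = g' ∧ h = h' := by
  obtain ⟨h1, h2⟩ := hX.sq_unique s.reflect s'.reflect
  exact ⟨h1, rev_injective h2⟩

/-- Three squares that pairwise share an edge at a corner are faces of a `3`-cube. -/
theorem NonpositivelyCurved.sq_cube (hX : X.NonpositivelyCurved)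
    {a b c a' a'' b' b'' c' c'' : X.Cube 1}
    (sab : Sq a b' b a') (sac : Sq a c' c a'') (sbc : Sq b c'' c b'') :
    ∃ a3 b3 c3, Sq b' c3 c' b3 ∧ Sq a' c3 c'' a3 ∧ Sq a'' b3 b'' a3 := by
  have h0 : (![false, false] : Fin 2 → Bool) = fun _ => false := by decide
  have key : ∀ {e f g h : X.Cube 1}, Sq e f g h → ∃ c : X.Cube 2,
      X.edge c (fun _ => false) 0 = e ∧ X.edge c (fun _ => false) 1 = g := by
    rintro _ _ _ _ ⟨c, rfl, -, rfl, -⟩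
    exact ⟨c, by rw [h0], by rw [h0]⟩
  obtain ⟨k, -, hk⟩ := hX.link_flag (X.src a) ![a, b, c] (by
      have := hX.sq_ne sab
      have := hX.sq_ne sac
      have := hX.sq_ne sbc
      intro i j hij
      fin_cases i <;> fin_cases j <;> simp_all) (by
      intro i
      fin_cases i
      · rfl
      · exact sab.src_eq.symm
      · exact sac.src_eq.symm) (by
      intro i j hij
      fin_cases i <;> fin_cases j
      · exact absurd rfl hij
      · exact key sab
      · exact key sac
      · exact key sab.symm
      · exact absurd rfl hij
      · exact key sbc
      · exact key sac.symm
      · exact key sbc.symm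
      · exact absurd rfl hij)
  obtain ⟨ha, hb, hc⟩ : X.edge k (fun _ => false) 0 = a ∧ X.edge k (fun _ => false) 1 = b ∧
    X.edge k (fun _ => false) 2 = c := ⟨hk 0, hk 1, hk 2⟩
  have s01 := sq_edge k (fun _ => false) (i := 0) (j := 1) (by decide)
  have s02 := sq_edge k (fun _ => false) (i := 0) (j := 2) (by decide)
  have s12 := sq_edge k (fun _ => false) (i := 1) (j := 2) (by decide)
  rw [ha, hb] at s01
  rw [ha, hc] at s02
  rw [hb, hc] at s12
  obtain ⟨rfl, rfl⟩ := hX.sq_unique sab s01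
  obtain ⟨rfl, rfl⟩ := hX.sq_unique sac s02
  obtain ⟨rfl, rfl⟩ := hX.sq_unique sbc s12
  refine ⟨X.edge k ![false, true, true] 0, X.edge k ![true, false, true] 1,
    X.edge k ![true, true, false] 2, ?_, ?_, ?_⟩
  · convert sq_edge k ![true, false, false] (i := 1) (j := 2) (by decide) using 2 <;> decide
  · convert sq_edge k ![false, true, false] (i := 0) (j := 2) (by decide) using 2 <;> decide
  · convert sq_edge k ![false, false, true] (i := 0) (j := 1) (by decide) using 2 <;> decide

end CubeComplex

theorem isEdgePath_append {V E : Type*} {src tgt : E → V} {x y : V} {l l' : List E} :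
    IsEdgePath src tgt x (l ++ l') y ↔
      ∃ z, IsEdgePath src tgt x l z ∧ IsEdgePath src tgt z l' y := by
  induction l generalizing x with
  | nil => simp [IsEdgePath]
  | cons e l ih => simp [IsEdgePath, ih, and_assoc]

namespace CubeComplex

variable {X : CubeComplex.{v}}

/-! ### Square moves on edge paths -/

/-- Pushing a list of edges across one square. -/
inductive Flip : List (X.Cube 1) → List (X.Cube 1) → Prop
  | head {e f g h : X.Cube 1} (s : Sq e f g h) (q : List (X.Cube 1)) :
      Flip (e :: f :: q) (g :: h :: q)
  | cons (a : X.Cube 1) {p q : List (X.Cube 1)} : Flip p q → Flip (a :: p) (a :: q)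

/-- Lists of edges that differ by square moves. -/
def FlipEquiv : List (X.Cube 1) → List (X.Cube 1) → Prop := Relation.ReflTransGen Flip

theorem Flip.symm {p q : List (X.Cube 1)} (h : Flip p q) : Flip q p := by
  induction h with
  | head s q => exact .head s.symm q
  | cons a _ ih => exact .cons a ih

theorem Flip.append_right {p q : List (X.Cube 1)} (h : Flip p q) (r : List (X.Cube 1)) :
    Flip (p ++ r) (q ++ r) := by
  induction h with
  | head s q => exact .head s _
  | cons a _ ih => exact .cons a ih

theorem Flip.length_eq {p q : List (X.Cube 1)} (h : Flip p q) : p.length = q.length := by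
  induction h with
  | head s q => rfl
  | cons a _ ih => simp [ih]

namespace FlipEquiv

variable {p q r : List (X.Cube 1)}

@[refl] theorem refl (p : List (X.Cube 1)) : FlipEquiv p p := Relation.ReflTransGen.refl

theorem symm (h : FlipEquiv p q) : FlipEquiv q p := by
  induction h with
  | refl => exact refl _
  | tail _ h ih => exact Relation.ReflTransGen.head h.symm ih

theorem trans (h : FlipEquiv p q) (h' : FlipEquiv q r) : FlipEquiv p r :=
  Relation.ReflTransGen.trans h h'

theorem cons (a : X.Cube 1) (h : FlipEquiv p q) : FlipEquiv (a :: p) (a :: q) := by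
  induction h with
  | refl => exact refl _
  | tail _ h ih => exact ih.tail (.cons a h)

theorem sq {e f g h : X.Cube 1} (s : Sq e f g h) (q : List (X.Cube 1)) :
    FlipEquiv (e :: f :: q) (g :: h :: q) := .single (.head s q)

theorem length_eq (h : FlipEquiv p q) : p.length = q.length := by
  induction h with
  | refl => rfl
  | tail _ h ih => exact ih.trans h.length_eq

end FlipEquiv

/-- Two lists that differ by square moves have the same first edge, or their first edges span
a square. -/
theorem NonpositivelyCurved.flipEquiv_cons (hX : X.NonpositivelyCurved) :
    ∀ (N : ℕ) (p : List (X.Cube 1)) (f h : X.Cube 1) (r : List (X.Cube 1)), p.length = N →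
      FlipEquiv (f :: p) (h :: r) → (f = h ∧ FlipEquiv p r) ∨
        ∃ q h' f', Sq f h' h f' ∧ FlipEquiv p (h' :: q) ∧ FlipEquiv r (f' :: q) := by
  intro N
  induction N using Nat.strong_induction_on with
  | _ N IH =>
  intro p f h r hp H
  generalize hw : h :: r = w at H
  induction H generalizing h r with
  | refl =>
    cases hw
    exact .inl ⟨rfl, .refl _⟩
  | @tail w₁ w₂ H1 H2 ih =>
    subst hw
    generalize hw' : h :: r = w' at H2
    cases H2 with
    | @cons a r1 r' H3 =>
      cases hw'
      rcases ih _ _ rfl with ⟨rfl, h1⟩ | ⟨q, h', f', s, h1, h2⟩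
      · exact .inl ⟨rfl, h1.tail H3⟩
      · exact .inr ⟨q, h', f', s, h1, (FlipEquiv.symm (.single H3)).trans h2⟩
    | @head h1 k h2 k2 s2 r0 =>
      cases hw'
      rcases ih _ _ rfl with ⟨rfl, h3⟩ | ⟨q, h', f', s, h3, h4⟩
      · exact .inr ⟨r0, _, _, s2, h3, .refl _⟩
      -- The intermediate first edge spans a square both with the old and with the new first edge.
      -- The outer induction compares the shorter tails: either they share their first edge and the
      -- last move undoes the earlier square, or three squares meet at the end of the intermediate
      -- edge, and the `3`-cube they span has the required square as a face.
      · have hl : r0.length + 1 = p.length := by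
          have := h3.length_eq
          have := h4.length_eq
          simp at *
          omega
        rcases IH r0.length (by omega) r0 _ _ q rfl h4 with ⟨rfl, h5⟩ | ⟨t, l, j, s3, h5, h6⟩
        · obtain ⟨rfl, rfl⟩ := hX.sq_unique_path s.symm s2
          exact .inl ⟨rfl, h3.trans (h5.symm.cons _)⟩
        · obtain ⟨a3, b3, c3, o1, o2, o3⟩ := hX.sq_cube s.symm.reflect s2.reflect s3.symm
          have o2' := o2.reflect
          have o3' := o3.reflect
          rw [rev_rev] at o2' o3'
          refine .inr ⟨X.rev a3 :: t, c3, b3, o1, ?_, ?_⟩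
          · exact (h3.trans (h6.cons _)).trans (.sq o2' _)
          · exact (h5.cons _).trans (.sq o3' _)

theorem NonpositivelyCurved.flipEquiv_cons_cons (hX : X.NonpositivelyCurved)
    {p r : List (X.Cube 1)} {f h : X.Cube 1} (H : FlipEquiv (f :: p) (h :: r)) :
    (f = h ∧ FlipEquiv p r) ∨
      ∃ q h' f', Sq f h' h f' ∧ FlipEquiv p (h' :: q) ∧ FlipEquiv r (f' :: q) :=
  hX.flipEquiv_cons _ p f h r rfl H

theorem NonpositivelyCurved.flipEquiv_cancel (hX : X.NonpositivelyCurved)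
    {p r : List (X.Cube 1)} {f : X.Cube 1} (H : FlipEquiv (f :: p) (f :: r)) : FlipEquiv p r := by
  rcases hX.flipEquiv_cons_cons H with ⟨-, h⟩ | ⟨q, h', f', s, -, -⟩
  · exact h
  · exact absurd rfl (hX.sq_ne s)

/-! ### Reduced lists of edges -/

/-- The list contains an edge followed by its reverse. -/
inductive HasBacktrack : List (X.Cube 1) → Prop
  | head (e : X.Cube 1) (q : List (X.Cube 1)) : HasBacktrack (e :: X.rev e :: q)
  | cons (a : X.Cube 1) {p : List (X.Cube 1)} : HasBacktrack p → HasBacktrack (a :: p)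

/-- Some list that differs by square moves has a backtrack. -/
def Reducible (p : List (X.Cube 1)) : Prop := ∃ q, FlipEquiv p q ∧ HasBacktrack q

theorem Reducible.congr {p q : List (X.Cube 1)} (h : FlipEquiv p q) (hp : Reducible p) :
    Reducible q :=
  let ⟨r, h1, h2⟩ := hp
  ⟨r, h.symm.trans h1, h2⟩

theorem Reducible.cons (a : X.Cube 1) {p : List (X.Cube 1)} (hp : Reducible p) :
    Reducible (a :: p) :=
  let ⟨r, h1, h2⟩ := hp
  ⟨a :: r, h1.cons a, h2.cons a⟩

theorem Reducible.append_right {p : List (X.Cube 1)} (q : List (X.Cube 1)) (hp : Reducible p) :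
    Reducible (p ++ q) := by
  obtain ⟨r, h1, h2⟩ := hp
  refine ⟨r ++ q, ?_, ?_⟩
  · clear h2
    induction h1 with
    | refl => exact .refl _
    | tail _ h ih =>
      exact ih.tail (h.append_right q)
  · clear h1
    induction h2 with
    | head e q => exact .head e _
    | cons a _ ih => exact .cons a ih

theorem not_reducible_nil : ¬ Reducible ([] : List (X.Cube 1)) := by
  rintro ⟨q, h1, h2⟩
  have := h1.length_eq
  cases h2 <;> simp at this

/-- A backtrack that appears after square moves either avoids the new first edge, and is then
already present in `p`, or cancels it, and then `p` can be moved to start with its reverse. -/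
theorem NonpositivelyCurved.reducible_cons_aux (hX : X.NonpositivelyCurved) :
    ∀ (N : ℕ) (p : List (X.Cube 1)) (e : X.Cube 1), p.length = N → Reducible (e :: p) →
      Reducible p ∨ ∃ r, FlipEquiv p (X.rev e :: r) := by
  intro N
  induction N using Nat.strong_induction_on with
  | _ N IH =>
  rintro p e hp ⟨w, hw, hb⟩
  match w, hw, hb with
  | [], hw, _ => exact absurd hw.length_eq (by simp)
  | h :: w', hw, hb =>
  rcases hX.flipEquiv_cons_cons hw with ⟨rfl, h1⟩ | ⟨q, h', e', s, h1, h2⟩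
  · cases hb with
    | head => exact .inr ⟨_, h1⟩
    | cons _ hb => exact .inl ⟨_, h1, hb⟩
  · cases hb with
    | cons _ hb =>
      have hr : Reducible (e' :: q) := ⟨w', h2.symm, hb⟩
      have hl : q.length < N := by
        have := h1.length_eq
        simp at this
        omega
      rcases IH _ hl q e' rfl hr with h3 | ⟨r, h3⟩
      · exact .inl ((h3.cons h').congr h1.symm)
      · have s' : Sq (X.rev e) h h' (X.rev e') := s.reflect
        exact .inr ⟨h :: r, (h1.trans (h3.cons _)).trans (.sq s'.symm _)⟩
    | head _ v =>
      have s' := s.symm.reflect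
      rcases hX.flipEquiv_cons_cons h2 with ⟨rfl, h3⟩ | ⟨t, j, l, s2, h3, h4⟩
      · exact absurd rfl (hX.sq_ne s')
      · obtain ⟨rfl, rfl⟩ := hX.sq_unique s' s2
        exact .inl ⟨_, h1.trans (h4.cons _), by simpa using HasBacktrack.head h' t⟩

theorem NonpositivelyCurved.reducible_cons (hX : X.NonpositivelyCurved) {p : List (X.Cube 1)}
    {e : X.Cube 1} (h : Reducible (e :: p)) : Reducible p ∨ ∃ r, FlipEquiv p (X.rev e :: r) :=
  hX.reducible_cons_aux _ p e rfl h

/-! ### Normal forms -/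

/-- Lists of edges up to square moves. -/
def flipSetoid (X : CubeComplex.{v}) : Setoid (List (X.Cube 1)) :=
  ⟨FlipEquiv, fun p => .refl p, fun h => h.symm, fun h h' => h.trans h'⟩

/-- The class of a list of edges up to square moves. -/
def flipClass (p : List (X.Cube 1)) : Quotient (flipSetoid X) := Quotient.mk _ p

theorem flipClass_eq {p q : List (X.Cube 1)} : flipClass p = flipClass q ↔ FlipEquiv p q :=
  Quotient.eq (r := flipSetoid X)

open Classical in
/-- Multiplication of a class by an edge on the left, followed by cancellation. -/
noncomputable def mulEdge (e : X.Cube 1) (q : Quotient (flipSetoid X)) :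
    Quotient (flipSetoid X) :=
  if h : ∃ r, q = flipClass (X.rev e :: r) then flipClass h.choose
  else flipClass (e :: q.out)

/-- The class consists of reduced lists. -/
def IsReducedClass (q : Quotient (flipSetoid X)) : Prop := ∃ p, q = flipClass p ∧ ¬ Reducible p

theorem isReducedClass_flipClass {p : List (X.Cube 1)} :
    IsReducedClass (flipClass p) ↔ ¬ Reducible p :=
  ⟨fun ⟨_, h1, h2⟩ h => h2 (h.congr (flipClass_eq.1 h1)), fun h => ⟨p, rfl, h⟩⟩

/-- Left cancellation makes the choice in `mulEdge` immaterial. -/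
theorem NonpositivelyCurved.mulEdge_of_cancel (hX : X.NonpositivelyCurved) (e : X.Cube 1)
    (r : List (X.Cube 1)) :
    mulEdge e (flipClass (X.rev e :: r)) = flipClass r := by
  have h : ∃ r', flipClass (X.rev e :: r) = flipClass (X.rev e :: r') := ⟨r, rfl⟩
  rw [mulEdge, dif_pos h]
  exact flipClass_eq.2 (hX.flipEquiv_cancel (flipClass_eq.1 h.choose_spec)).symm

theorem mulEdge_of_not {e : X.Cube 1} {p : List (X.Cube 1)}
    (h : ¬ ∃ r, FlipEquiv p (X.rev e :: r)) : mulEdge e (flipClass p) = flipClass (e :: p) := by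
  have h' : ¬ ∃ r, flipClass p = flipClass (X.rev e :: r) :=
    fun ⟨r, hr⟩ => h ⟨r, flipClass_eq.1 hr⟩
  rw [mulEdge, dif_neg h', flipClass_eq]
  exact FlipEquiv.cons _ (flipClass_eq.1 (Quotient.out_eq (s := flipSetoid X) _))

theorem NonpositivelyCurved.isReducedClass_mulEdge (hX : X.NonpositivelyCurved) (e : X.Cube 1)
    {q : Quotient (flipSetoid X)} (hq : IsReducedClass q) : IsReducedClass (mulEdge e q) := by
  obtain ⟨p, rfl, hp⟩ := hq
  by_cases h : ∃ r, FlipEquiv p (X.rev e :: r)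
  · obtain ⟨r, hr⟩ := h
    rw [flipClass_eq.2 hr, hX.mulEdge_of_cancel, isReducedClass_flipClass]
    exact fun h' => hp ((h'.cons _).congr hr.symm)
  · rw [mulEdge_of_not h, isReducedClass_flipClass]
    exact fun h' => (hX.reducible_cons h').elim hp h

/-- With `mulEdge_sq` this is van der Waerden's argument for normal forms: edges act on reduced
classes and the action respects both elementary homotopies. -/
theorem NonpositivelyCurved.mulEdge_mulEdge_rev (hX : X.NonpositivelyCurved) (e : X.Cube 1)
    {q : Quotient (flipSetoid X)} (hq : IsReducedClass q) :
    mulEdge e (mulEdge (X.rev e) q) = q := by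
  obtain ⟨p, rfl, hp⟩ := hq
  by_cases h : ∃ r, FlipEquiv p (X.rev (X.rev e) :: r)
  · obtain ⟨r, hr⟩ := h
    rw [flipClass_eq.2 hr, hX.mulEdge_of_cancel, mulEdge_of_not, rev_rev]
    rintro ⟨r', hr'⟩
    refine hp ⟨_, hr.trans (hr'.cons _), ?_⟩
    rw [rev_rev]
    exact .head _ _
  · rw [mulEdge_of_not h, hX.mulEdge_of_cancel]

/-- The cases are which of `f`, `h` cancels against `q`. If both do, the two reversed edges span the
square at its far corner and both sides equal the remaining tail. If neither does, the first edges
do not cancel afterwards either, and the results differ by one square move. -/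
theorem NonpositivelyCurved.mulEdge_sq (hX : X.NonpositivelyCurved) {e f g h : X.Cube 1}
    (s : Sq e f g h)
    (q : Quotient (flipSetoid X)) :
    mulEdge e (mulEdge f q) = mulEdge g (mulEdge h q) := by
  obtain ⟨p, rfl⟩ : ∃ p, q = flipClass p := ⟨q.out, (Quotient.out_eq (s := flipSetoid X) _).symm⟩
  have so := s.opposite
  have key : ∀ {e f g h : X.Cube 1} (_ : Sq e f g h) (_ : ∃ r, FlipEquiv p (X.rev f :: r))
      (_ : ¬ ∃ r, FlipEquiv p (X.rev h :: r)),
      mulEdge e (mulEdge f (flipClass p)) = mulEdge g (mulEdge h (flipClass p)) := by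
    rintro e f g h s ⟨r, hr⟩ h2
    have so := s.opposite
    rw [mulEdge_of_not h2, flipClass_eq.2 hr, hX.mulEdge_of_cancel, mulEdge_of_not,
      flipClass_eq.2 ((hr.cons h).trans (.sq (s.symm.reflect.symm : Sq h (X.rev f) (X.rev g) e) r)),
      hX.mulEdge_of_cancel]
    rintro ⟨r', hr'⟩
    exact h2 ⟨_, (hr.trans (hr'.cons _)).trans (.sq so _)⟩
  by_cases h1 : ∃ r, FlipEquiv p (X.rev f :: r) <;> by_cases h2 : ∃ r, FlipEquiv p (X.rev h :: r)
  · obtain ⟨r, hr⟩ := h1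
    obtain ⟨r', hr'⟩ := h2
    rcases hX.flipEquiv_cons_cons (hr.symm.trans hr') with ⟨h3, -⟩ | ⟨t, j, l, s2, h3, h4⟩
    · exact absurd h3 (hX.sq_ne so)
    · obtain ⟨rfl, rfl⟩ := hX.sq_unique so s2
      conv_lhs => rw [flipClass_eq.2 hr, hX.mulEdge_of_cancel, flipClass_eq.2 h3,
        hX.mulEdge_of_cancel]
      rw [flipClass_eq.2 hr', hX.mulEdge_of_cancel, flipClass_eq.2 h4, hX.mulEdge_of_cancel]
  · exact key s h1 h2
  · exact (key s.symm h2 h1).symm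
  · have key2 : ∀ {e f g h : X.Cube 1} (_ : Sq e f g h) (_ : ¬ ∃ r, FlipEquiv p (X.rev f :: r))
        (_ : ¬ ∃ r, FlipEquiv p (X.rev h :: r)),
        mulEdge e (mulEdge f (flipClass p)) = flipClass (e :: f :: p) := by
      intro e f g h s h1 h2
      rw [mulEdge_of_not h1, mulEdge_of_not]
      rintro ⟨r, hr⟩
      have s1 : Sq f (X.rev h) (X.rev e) g := s.reflect.symm
      rcases hX.flipEquiv_cons_cons hr with ⟨rfl, -⟩ | ⟨t, j, l, s2, h3, -⟩
      · exact hX.sq_ne s1 rfl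
      · obtain ⟨rfl, rfl⟩ := hX.sq_unique s1 s2
        exact h2 ⟨_, h3⟩
    rw [key2 s h1 h2, key2 s.symm h2 h1, flipClass_eq]
    exact .sq s _

/-- The reduced form of a list of edges. -/
noncomputable def normalForm (l : List (X.Cube 1)) : Quotient (flipSetoid X) :=
  l.foldr mulEdge (flipClass [])

theorem normalForm_append (p q : List (X.Cube 1)) :
    normalForm (p ++ q) = p.foldr mulEdge (normalForm q) := by
  rw [normalForm, normalForm, List.foldr_append]

theorem NonpositivelyCurved.isReducedClass_foldr (hX : X.NonpositivelyCurved)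
    (l : List (X.Cube 1)) {q : Quotient (flipSetoid X)} (hq : IsReducedClass q) :
    IsReducedClass (l.foldr mulEdge q) := by
  induction l with
  | nil => exact hq
  | cons a l ih => exact hX.isReducedClass_mulEdge a ih

theorem NonpositivelyCurved.isReducedClass_normalForm (hX : X.NonpositivelyCurved)
    (l : List (X.Cube 1)) : IsReducedClass (normalForm l) :=
  hX.isReducedClass_foldr l (isReducedClass_flipClass.2 not_reducible_nil)

theorem normalForm_of_not_reducible
    {l : List (X.Cube 1)} (hl : ¬ Reducible l) : normalForm l = flipClass l := by
  induction l with
  | nil => rfl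
  | cons a l ih =>
    have h1 : normalForm (a :: l) = mulEdge a (normalForm l) := rfl
    rw [h1, ih fun h => hl (h.cons a), mulEdge_of_not]
    rintro ⟨r, hr⟩
    exact hl ⟨_, hr.cons a, .head _ _⟩

theorem NonpositivelyCurved.normalForm_elementary (hX : X.NonpositivelyCurved)
    {l l' : List (X.Cube 1)} (h : X.Elementary l l') : normalForm l = normalForm l' := by
  cases h with
  | backtrack p q e =>
    rw [List.append_assoc, normalForm_append p, normalForm_append p]
    exact congrArg (fun z => p.foldr mulEdge z)
      (hX.mulEdge_mulEdge_rev e (hX.isReducedClass_normalForm q))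
  | square p q c =>
    rw [List.append_assoc, List.append_assoc, normalForm_append p, normalForm_append p]
    exact congrArg (fun z => p.foldr mulEdge z)
      (hX.mulEdge_sq ⟨c, rfl, rfl, rfl, rfl⟩ (normalForm q))

theorem NonpositivelyCurved.normalForm_homotopic (hX : X.NonpositivelyCurved)
    {x y : X.Cube 0} {l l' : List (X.Cube 1)} (h : X.Homotopic x y l l') :
    normalForm l = normalForm l' := by
  induction h with
  | rel _ _ h => exact hX.normalForm_elementary h.2.2
  | refl => rfl
  | symm _ _ _ ih => exact ih.symm
  | trans _ _ _ _ _ ih1 ih2 => exact ih1.trans ih2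

/-! ### Paths -/

theorem isPath_nil {x y : X.Cube 0} : X.IsPath x [] y ↔ x = y := Iff.rfl

theorem isPath_cons {x y : X.Cube 0} {e : X.Cube 1} {l : List (X.Cube 1)} :
    X.IsPath x (e :: l) y ↔ X.src e = x ∧ X.IsPath (X.tgt e) l y := Iff.rfl

theorem isPath_append {x y : X.Cube 0} {l l' : List (X.Cube 1)} :
    X.IsPath x (l ++ l') y ↔ ∃ z, X.IsPath x l z ∧ X.IsPath z l' y := isEdgePath_append

/-- The path traversed backwards. -/
def inv (l : List (X.Cube 1)) : List (X.Cube 1) := (l.map X.rev).reverse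

theorem inv_cons (e : X.Cube 1) (l : List (X.Cube 1)) : inv (e :: l) = inv l ++ [X.rev e] := by
  simp [inv]

theorem IsPath.inv {x y : X.Cube 0} {l : List (X.Cube 1)} (h : X.IsPath x l y) :
    X.IsPath y (inv l) x := by
  induction l generalizing x with
  | nil => exact Eq.symm h
  | cons e l ih =>
    rw [inv_cons, isPath_append]
    exact ⟨_, ih h.2, by simp [isPath_cons, isPath_nil, h.1]⟩

theorem IsPath.flip {x y : X.Cube 0} {l l' : List (X.Cube 1)} (h : X.IsPath x l y)
    (hf : Flip l l') : X.IsPath x l' y := by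
  induction hf generalizing x with
  | head s q =>
    obtain ⟨h1, -, h3⟩ := h
    exact ⟨s.src_eq.symm.trans h1, s.symm.tgt_eq_src.symm, s.tgt_eq ▸ h3⟩
  | cons a _ ih => exact ⟨h.1, ih h.2⟩

theorem IsPath.flipEquiv {x y : X.Cube 0} {l l' : List (X.Cube 1)} (h : X.IsPath x l y)
    (hf : FlipEquiv l l') : X.IsPath x l' y := by
  induction hf with
  | refl => exact h
  | tail _ h1 ih => exact ih.flip h1

theorem IsPath.remove_backtrack {x y : X.Cube 0} {e : X.Cube 1} {p q : List (X.Cube 1)}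
    (h : X.IsPath x (p ++ e :: X.rev e :: q) y) : X.IsPath x (p ++ q) y := by
  obtain ⟨z, h1, h2, h3, h4⟩ := isPath_append.1 h
  rw [tgt_rev, h2] at h4
  exact isPath_append.2 ⟨z, h1, h4⟩

theorem hasBacktrack_iff {l : List (X.Cube 1)} :
    HasBacktrack l ↔ ∃ p e q, l = p ++ e :: X.rev e :: q := by
  constructor
  · intro h
    induction h with
    | head e q => exact ⟨[], e, q, rfl⟩
    | cons a _ ih =>
      obtain ⟨p, e, q, rfl⟩ := ih
      exact ⟨a :: p, e, q, rfl⟩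
  · rintro ⟨p, e, q, rfl⟩
    induction p with
    | nil => exact .head e q
    | cons a p ih => exact .cons a ih

/-- A property that is preserved by square moves and by removing backtracks passes to some
reduced list. -/
theorem exists_not_reducible {P : List (X.Cube 1) → Prop}
    (hflip : ∀ p q, Flip p q → P p → P q)
    (hback : ∀ p e q, P (p ++ e :: X.rev e :: q) → P (p ++ q)) {l : List (X.Cube 1)} (hl : P l) :
    ∃ r, P r ∧ ¬ Reducible r := by
  generalize hN : l.length = N
  induction N using Nat.strong_induction_on generalizing l with
  | _ N IH =>
  by_cases h : Reducible l
  · obtain ⟨r, h1, h2⟩ := h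
    have hr : P r := by
      clear h2
      induction h1 with
      | refl => exact hl
      | tail _ h3 ih => exact hflip _ _ h3 ih
    obtain ⟨p, e, q, rfl⟩ := hasBacktrack_iff.1 h2
    have := h1.length_eq
    refine IH _ ?_ (hback _ _ _ hr) rfl
    simp at *
    omega
  · exact ⟨l, hl, h⟩

namespace IsCAT0

/-- The loop `inv l' ++ l` is contractible, so it has the empty normal form. Acting by `l'` undoes
the action of `inv l'` on reduced classes. -/
theorem normalForm_eq (hX : X.IsCAT0) {x y : X.Cube 0} {l l' : List (X.Cube 1)}
    (h : X.IsPath x l y) (h' : X.IsPath x l' y) : normalForm l = normalForm l' := by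
  have hN := hX.nonpositivelyCurved
  have h1 := hN.normalForm_homotopic
    (hX.simplyConnected.contractible y (inv l' ++ l) (isPath_append.2 ⟨_, h'.inv, h⟩))
  have h2 : ∀ (m : List (X.Cube 1)) (q : Quotient (flipSetoid X)), IsReducedClass q →
      m.foldr mulEdge ((inv m).foldr mulEdge q) = q := by
    intro m
    induction m with
    | nil => intro q _; rfl
    | cons e m ih =>
      intro q hq
      rw [inv_cons, List.foldr_append, List.foldr_cons]
      exact (congrArg (mulEdge e) (ih _ (hN.isReducedClass_mulEdge _ hq))).trans
        (hN.mulEdge_mulEdge_rev e hq)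
  rw [normalForm_append] at h1
  rw [← h2 l' _ (hN.isReducedClass_normalForm l), h1]
  rfl

/-- Reduced paths with the same endpoints differ by square moves. -/
theorem flipEquiv (hX : X.IsCAT0) {x y : X.Cube 0} {l l' : List (X.Cube 1)}
    (h : X.IsPath x l y) (h' : X.IsPath x l' y) (hl : ¬ Reducible l) (hl' : ¬ Reducible l') :
    FlipEquiv l l' := by
  rw [← flipClass_eq, ← normalForm_of_not_reducible hl,
    ← normalForm_of_not_reducible hl', hX.normalForm_eq h h']

end IsCAT0

end CubeComplex

namespace CubeComplex

variable {X : CubeComplex.{v}}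

/-! ### Ladders -/

/-- `Ladder e m e'`: the edge `e` is carried to `e'` along the list `m` by a strip of squares. -/
inductive Ladder : X.Cube 1 → List (X.Cube 1) → X.Cube 1 → Prop
  | nil (e : X.Cube 1) : Ladder e [] e
  | cons {e f f' e₁ e' : X.Cube 1} {m : List (X.Cube 1)} (s : Sq e f' f e₁) :
      Ladder e₁ m e' → Ladder e (f :: m) e'

theorem Ladder.dual_eq {e e' : X.Cube 1} {m : List (X.Cube 1)} (h : Ladder e m e') :
    X.dual e = X.dual e' := by
  induction h with
  | nil => rfl
  | cons s _ ih => exact s.dual_eq.trans ih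

theorem ladder_append {e e' : X.Cube 1} {m m' : List (X.Cube 1)} :
    Ladder e (m ++ m') e' ↔ ∃ k, Ladder e m k ∧ Ladder k m' e' := by
  constructor
  · intro h
    induction m generalizing e with
    | nil => exact ⟨e, .nil e, h⟩
    | cons f m ih =>
      cases h with
      | cons s h =>
        obtain ⟨k, h1, h2⟩ := ih h
        exact ⟨k, .cons s h1, h2⟩
  · rintro ⟨k, h1, h2⟩
    induction h1 with
    | nil => exact h2
    | cons s _ ih => exact .cons s (ih h2)

/-- A strip of squares has a second rail, along which the reversed rungs form a ladder. -/
theorem Ladder.exists_parallel {x y : X.Cube 0} {e e' : X.Cube 1} {m : List (X.Cube 1)}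
    (h : Ladder e m e') (he : X.src e = x) (hp : X.IsPath x m y) :
    X.src e' = y ∧ ∃ m', X.IsPath (X.tgt e) m' (X.tgt e') ∧ Ladder (X.rev e) m' (X.rev e') := by
  induction h generalizing x with
  | nil e => exact ⟨he.trans hp, [], rfl, .nil _⟩
  | @cons e f f' e₁ e' m s h ih =>
    obtain ⟨-, h2⟩ := hp
    obtain ⟨h3, m', h4, h5⟩ := ih s.symm.tgt_eq_src.symm h2
    exact ⟨h3, f' :: m', ⟨s.tgt_eq_src.symm, s.tgt_eq ▸ h4⟩, .cons s.reflect h5⟩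

theorem Ladder.inv {e e' : X.Cube 1} {m : List (X.Cube 1)} (h : Ladder e m e') :
    Ladder e' (inv m) e := by
  induction h with
  | nil e => exact .nil e
  | cons s _ ih =>
    rw [inv_cons, ladder_append]
    exact ⟨_, ih, .cons s.symm.reflect.symm (.nil _)⟩

/-- Two consecutive squares of the strip and the square of the move meet at a corner and span a
`3`-cube; its opposite faces form the new strip. -/
theorem Ladder.flip (hX : X.NonpositivelyCurved) {e e' : X.Cube 1} {m m' : List (X.Cube 1)}
    (h : Ladder e m e') (hf : Flip m m') : Ladder e m' e' := by
  induction hf generalizing e with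
  | cons a _ ih =>
    cases h with
    | cons s h => exact .cons s (ih h)
  | head s q =>
    cases h with
    | cons s1 h =>
      cases h with
      | cons s2 h =>
        obtain ⟨a3, b3, c3, o1, -, o3⟩ := hX.sq_cube s1.symm.reflect s.reflect s2
        have o3' := o3.reflect.symm
        rw [rev_rev] at o3'
        exact .cons o1 (.cons o3' h)

theorem Ladder.flipEquiv (hX : X.NonpositivelyCurved) {e e' : X.Cube 1} {m m' : List (X.Cube 1)}
    (h : Ladder e m e') (hf : FlipEquiv m m') : Ladder e m' e' := by
  induction hf with
  | refl => exact h
  | tail _ h1 ih => exact ih.flip hX h1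

theorem Ladder.remove_backtrack (hX : X.NonpositivelyCurved) {e e' f : X.Cube 1}
    {p q : List (X.Cube 1)} (h : Ladder e (p ++ f :: X.rev f :: q) e') : Ladder e (p ++ q) e' := by
  obtain ⟨k, h1, h2⟩ := ladder_append.1 h
  refine ladder_append.2 ⟨k, h1, ?_⟩
  cases h2 with
  | cons s1 h2 =>
    cases h2 with
    | cons s2 h2 =>
      obtain ⟨-, rfl⟩ := hX.sq_unique s1.symm.reflect.symm s2
      exact h2

namespace IsCAT0

theorem exists_path (hX : X.IsCAT0) (x y : X.Cube 0) : ∃ l, X.IsPath x l y ∧ ¬ Reducible l := by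
  obtain ⟨l, hl⟩ := hX.simplyConnected.connected x y
  exact exists_not_reducible (P := fun l => X.IsPath x l y)
    (fun p q hf h => h.flip hf) (fun p e q h => h.remove_backtrack) hl

/-- A ladder along some path is a ladder along each reduced path. -/
theorem ladder_of_path (hX : X.IsCAT0) {x y : X.Cube 0} {e e' : X.Cube 1} {m m' : List (X.Cube 1)}
    (h : Ladder e m e') (hm : X.IsPath x m y) (hm' : X.IsPath x m' y) (hr : ¬ Reducible m') :
    Ladder e m' e' := by
  obtain ⟨r, ⟨h1, h2⟩, h3⟩ := exists_not_reducible
    (P := fun l => X.IsPath x l y ∧ Ladder e l e')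
    (fun p q hf h => ⟨h.1.flip hf, h.2.flip hX.nonpositivelyCurved hf⟩)
    (fun p e q h => ⟨h.1.remove_backtrack, h.2.remove_backtrack hX.nonpositivelyCurved⟩)
    ⟨hm, h⟩
  exact h2.flipEquiv hX.nonpositivelyCurved (hX.flipEquiv h1 hm' h3 hr)

end IsCAT0

/-- Edges that are dual to the same hyperplane are joined by a ladder. -/
theorem exists_ladder {e e' : X.Cube 1} (h : X.dual e = X.dual e') :
    (∃ m, X.IsPath (X.src e) m (X.src e') ∧ Ladder e m e') ∨
      ∃ m, X.IsPath (X.src e) m (X.tgt e') ∧ Ladder e m (X.rev e') := by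
  have h' := Quot.eqvGen_exact h
  clear h
  have hrev : ∀ {e e' : X.Cube 1}, (∃ m, X.IsPath (X.src e) m (X.src e') ∧ Ladder e m e') →
      ∃ m, X.IsPath (X.tgt e) m (X.tgt e') ∧ Ladder (X.rev e) m (X.rev e') :=
    fun ⟨m, h1, h2⟩ => (h2.exists_parallel rfl h1).2
  have htrans : ∀ {e e' e'' : X.Cube 1}, (∃ m, X.IsPath (X.src e) m (X.src e') ∧ Ladder e m e') →
      (∃ m, X.IsPath (X.src e') m (X.src e'') ∧ Ladder e' m e'') →
      ∃ m, X.IsPath (X.src e) m (X.src e'') ∧ Ladder e m e'' :=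
    fun ⟨m, h1, h2⟩ ⟨m', h1', h2'⟩ =>
      ⟨m ++ m', isPath_append.2 ⟨_, h1, h1'⟩, ladder_append.2 ⟨_, h2, h2'⟩⟩
  have hsymm : ∀ {e e' : X.Cube 1}, (∃ m, X.IsPath (X.src e) m (X.src e') ∧ Ladder e m e') →
      ∃ m, X.IsPath (X.src e') m (X.src e) ∧ Ladder e' m e :=
    fun ⟨m, h1, h2⟩ => ⟨inv m, h1.inv, h2.inv⟩
  have key : (∃ m, X.IsPath (X.src e) m (X.src e') ∧ Ladder e m e') ∨
      ∃ m, X.IsPath (X.src e) m (X.src (X.rev e')) ∧ Ladder e m (X.rev e') := by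
    induction h' with
    | rel _ _ h =>
      cases h with
      | rev e => exact .inr ⟨[], by simp [isPath_nil], by rw [rev_rev]; exact .nil _⟩
      | opposite c =>
        have s : Sq _ _ _ _ := ⟨c, rfl, rfl, rfl, rfl⟩
        exact .inl ⟨[_], ⟨s.src_eq.symm, s.symm.tgt_eq_src⟩, .cons s (.nil _)⟩
    | refl e => exact .inl ⟨[], rfl, .nil _⟩
    | symm e e' _ ih =>
      rcases ih with h | h
      · exact .inl (hsymm h)
      · have h1 := hrev (hsymm h)
        rw [rev_rev, tgt_rev] at h1
        rw [src_rev]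
        exact .inr h1
    | trans a b c _ _ ih1 ih2 =>
      have hr2 : ∀ {e e' : X.Cube 1}, (∃ m, X.IsPath (X.src e) m (X.src e') ∧ Ladder e m e') →
          ∃ m, X.IsPath (X.src (X.rev e)) m (X.src (X.rev e')) ∧
            Ladder (X.rev e) m (X.rev e') := by
        intro e e' h
        rw [src_rev, src_rev]
        exact hrev h
      rcases ih1 with h1 | h1 <;> rcases ih2 with h2 | h2
      · exact .inl (htrans h1 h2)
      · exact .inr (htrans h1 h2)
      · exact .inr (htrans h1 (hr2 h2))
      · have h3 := htrans h1 (hr2 h2)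
        rw [rev_rev] at h3
        exact .inl h3
  rwa [src_rev] at key

/-- Pushing `e` across the strip, square by square, brings it next to `e'` as the reverse of `e'`.
-/
theorem Ladder.reducible {e e' : X.Cube 1} {m : List (X.Cube 1)} (h : Ladder (X.rev e) m e') :
    Reducible (e :: (m ++ [e'])) := by
  generalize hk : X.rev e = k at h
  induction h generalizing e with
  | nil => exact ⟨_, .refl _, hk ▸ .head _ _⟩
  | @cons k f f' e₁ e' m s h ih =>
    subst hk
    have s' := s.reflect
    rw [rev_rev] at s'
    exact ((ih (rev_rev e₁)).cons f').congr (FlipEquiv.sq s' _).symm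

theorem Flip.map_dual {p q : List (X.Cube 1)} (h : Flip p q) :
    (p.map X.dual).Perm (q.map X.dual) := by
  induction h with
  | head s q =>
    rw [List.map_cons, List.map_cons, List.map_cons, List.map_cons, s.dual_eq, s.symm.dual_eq]
    exact List.Perm.swap _ _ _
  | cons a _ ih => exact ih.cons _

theorem FlipEquiv.map_dual {p q : List (X.Cube 1)} (h : FlipEquiv p q) :
    (p.map X.dual).Perm (q.map X.dual) := by
  induction h with
  | refl => exact .refl _
  | tail _ h ih => exact ih.trans h.map_dual

namespace IsCAT0

/-- A reduced path crosses each hyperplane at most once. -/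
theorem nodup_dual (hX : X.IsCAT0) {x y : X.Cube 0} {l : List (X.Cube 1)} (hl : X.IsPath x l y)
    (hr : ¬ Reducible l) : (l.map X.dual).Nodup := by
  induction l generalizing x with
  | nil => simp
  | cons e l ih =>
    have hrl : ¬ Reducible l := fun h => hr (h.cons e)
    rw [List.map_cons, List.nodup_cons]
    refine ⟨fun hmem => ?_, ih hl.2 hrl⟩
    obtain ⟨e', he', hd⟩ := List.mem_map.1 hmem
    obtain ⟨m, v, rfl⟩ := List.append_of_mem he'
    obtain ⟨z, h1, h2, -⟩ := isPath_append.1 hl.2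
    have h3 : ¬ Reducible (m ++ [e']) := fun h => hrl (by
      have := h.append_right v
      rwa [List.append_assoc] at this)
    have h4 : ¬ Reducible m := fun h => h3 (h.append_right _)
    -- Depending on orientation, the strip lets `e` cancel against `e'`, or it runs along `m ++
    -- [e']` and its last square would span a corner with one edge used twice.
    rcases exists_ladder (e := X.rev e) (e' := e') (by rw [dual_rev, hd]) with
      ⟨m', h5, h6⟩ | ⟨m', h5, h6⟩
    · rw [src_rev, h2] at h5
      refine hr ?_
      have := (hX.ladder_of_path h6 h5 h1 h4).reducible.append_right v
      simpa using this
    · rw [src_rev] at h5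
      have h7 := hX.ladder_of_path h6 h5
        (isPath_append.2 ⟨z, h1, isPath_cons.2 ⟨h2, isPath_nil.2 rfl⟩⟩) h3
      obtain ⟨k, -, h8⟩ := ladder_append.1 h7
      cases h8 with
      | cons s h8 =>
        cases h8
        exact hX.nonpositivelyCurved.sq_ne s.symm.reflect rfl

/-- Square moves permute the crossed hyperplanes and removing a backtrack adds none, so a path that
avoids `H` reduces to one that avoids `H`. -/
theorem sameHalfspace_iff (hX : X.IsCAT0) {H : X.Hyperplane} {x y : X.Cube 0}
    {l : List (X.Cube 1)} (hl : X.IsPath x l y) (hr : ¬ Reducible l) :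
    SameHalfspace H x y ↔ H ∉ l.map X.dual := by
  refine ⟨fun ⟨l', h1, h2⟩ => ?_, fun h => ⟨l, hl, fun e he hd => h (List.mem_map.2 ⟨e, he, hd⟩)⟩⟩
  obtain ⟨r, ⟨h3, h4⟩, h5⟩ := exists_not_reducible
    (P := fun l => X.IsPath x l y ∧ H ∉ l.map X.dual)
    (fun p q hf h => ⟨h.1.flip hf, fun h' => h.2 (hf.map_dual.mem_iff.2 h')⟩)
    (fun p e q h => ⟨h.1.remove_backtrack, fun he => h.2 (by
      simp only [List.map_append, List.map_cons, List.mem_append, List.mem_cons] at he ⊢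
      tauto)⟩) (l := l') ⟨h1, fun h => by
        obtain ⟨e, he, hd⟩ := List.mem_map.1 h
        exact h2 e he hd⟩
  rwa [← (hX.flipEquiv h3 hl h5 hr).map_dual.mem_iff]

theorem separates_iff (hX : X.IsCAT0) {H : X.Hyperplane} {x y : X.Cube 0}
    {l : List (X.Cube 1)} (hl : X.IsPath x l y) (hr : ¬ Reducible l) :
    Separates H x y ↔ H ∈ l.map X.dual := by
  rw [Separates, hX.sameHalfspace_iff hl hr, not_not]

end IsCAT0

/-! ### Halfspaces -/

namespace SameHalfspace

theorem refl (H : X.Hyperplane) (x : X.Cube 0) : SameHalfspace H x x := ⟨[], rfl, by simp⟩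

theorem symm {H : X.Hyperplane} {x y : X.Cube 0} (h : SameHalfspace H x y) :
    SameHalfspace H y x := by
  obtain ⟨l, h1, h2⟩ := h
  refine ⟨inv l, h1.inv, fun e he => ?_⟩
  simp only [inv, List.mem_reverse, List.mem_map] at he
  obtain ⟨f, hf, rfl⟩ := he
  rw [dual_rev]
  exact h2 f hf

theorem trans {H : X.Hyperplane} {x y z : X.Cube 0} (h : SameHalfspace H x y)
    (h' : SameHalfspace H y z) : SameHalfspace H x z := by
  obtain ⟨l, h1, h2⟩ := h
  obtain ⟨l', h1', h2'⟩ := h'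
  refine ⟨l ++ l', isPath_append.2 ⟨_, h1, h1'⟩, fun e he => ?_⟩
  rcases List.mem_append.1 he with h | h
  · exact h2 e h
  · exact h2' e h

theorem of_edge {H : X.Hyperplane} {e : X.Cube 1} (h : X.dual e ≠ H) :
    SameHalfspace H (X.src e) (X.tgt e) :=
  ⟨[e], ⟨rfl, rfl⟩, by simpa using h⟩

end SameHalfspace

theorem Separates.symm {H : X.Hyperplane} {x y : X.Cube 0} (h : Separates H x y) :
    Separates H y x := fun h' => h h'.symm

theorem Separates.of_same_right {H : X.Hyperplane} {x y z : X.Cube 0} (h : Separates H x y)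
    (h' : SameHalfspace H y z) : Separates H x z := fun h1 => h (h1.trans h'.symm)

theorem Separates.of_same_left {H : X.Hyperplane} {x y z : X.Cube 0} (h : Separates H x y)
    (h' : SameHalfspace H x z) : Separates H z y := (h.symm.of_same_right h').symm

/-- A hyperplane that separates the ends of a path is dual to one of its edges. -/
theorem Separates.exists_edge {H : X.Hyperplane} {x y : X.Cube 0} (h : Separates H x y)
    {l : List (X.Cube 1)} (hl : X.IsPath x l y) : ∃ e ∈ l, X.dual e = H := by
  by_contra! h'
  exact h ⟨l, hl, h'⟩

theorem not_reducible_singleton (e : X.Cube 1) : ¬ Reducible [e] := by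
  rintro ⟨q, h1, h2⟩
  have := h1.length_eq
  cases h2 with
  | head => simp at this
  | cons _ h => cases h <;> simp at this

theorem flipEquiv_singleton {e : X.Cube 1} {p : List (X.Cube 1)} (h : FlipEquiv [e] p) :
    p = [e] := by
  induction h with
  | refl => rfl
  | tail _ h ih =>
    subst ih
    cases h with
    | cons _ h => cases h

namespace IsCAT0

theorem separates_dual (hX : X.IsCAT0) (e : X.Cube 1) :
    Separates (X.dual e) (X.src e) (X.tgt e) := by
  rw [hX.separates_iff (l := [e]) ⟨rfl, rfl⟩ (not_reducible_singleton e)]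
  simp

/-- A hyperplane has only two halfspaces. -/
theorem sameHalfspace_of_separates (hX : X.IsCAT0) {H : X.Hyperplane} {x y z : X.Cube 0}
    (h : Separates H x y) (h' : Separates H y z) : SameHalfspace H x z := by
  classical
  obtain ⟨l, h1, h2⟩ := hX.exists_path x y
  obtain ⟨l', h1', h2'⟩ := hX.exists_path y z
  -- The parity of the number of crossings of `H` survives reduction. The concatenated path crosses
  -- twice and a reduced path at most once, so it crosses zero times.
  obtain ⟨r, ⟨h3, h4⟩, h5⟩ := exists_not_reducible
    (P := fun l => X.IsPath x l z ∧ Even ((l.map X.dual).count H))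
    (fun p q hf h => ⟨h.1.flip hf, by rw [← hf.map_dual.count_eq]; exact h.2⟩)
    (fun p e q h => ⟨h.1.remove_backtrack, by
      have h0 := h.2
      simp only [List.map_append, List.map_cons, List.count_append, List.count_cons, dual_rev]
        at h0 ⊢
      split at h0 <;> grind⟩) (l := l ++ l') ⟨isPath_append.2 ⟨_, h1, h1'⟩, by
        rw [List.map_append, List.count_append,
          List.count_eq_one_of_mem (hX.nodup_dual h1 h2) ((hX.separates_iff h1 h2).1 h),
          List.count_eq_one_of_mem (hX.nodup_dual h1' h2') ((hX.separates_iff h1' h2').1 h')]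
        exact even_two⟩
  rw [hX.sameHalfspace_iff h3 h5]
  intro h6
  rw [List.count_eq_one_of_mem (hX.nodup_dual h3 h5) h6] at h4
  exact absurd h4 (by decide)

/-- The sides of a square are dual to two distinct hyperplanes. -/
theorem dual_ne_of_sq (hX : X.IsCAT0) {e f g h : X.Cube 1} (s : Sq e f g h) :
    X.dual e ≠ X.dual g := by
  have h1 : ¬ Reducible [X.rev e, g] := by
    intro h
    rcases hX.nonpositivelyCurved.reducible_cons h with h | ⟨r, hr⟩
    · exact not_reducible_singleton _ h
    · rw [rev_rev] at hr
      have := flipEquiv_singleton hr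
      simp only [List.cons.injEq] at this
      exact hX.nonpositivelyCurved.sq_ne s this.1
  have h2 := hX.nodup_dual (x := X.tgt e) (y := X.tgt g) 
    (isPath_cons.2 ⟨src_rev e, isPath_cons.2 ⟨by simp [s.src_eq], isPath_nil.2 rfl⟩⟩) h1
  simpa using h2

end IsCAT0

/-! ### Crossing and parallel hyperplanes -/

theorem crosses_iff {H H' : X.Hyperplane} :
    Crosses H H' ↔ H ≠ H' ∧ ∃ e f g h, Sq e f g h ∧ X.dual e = H ∧ X.dual g = H' :=
  ⟨fun ⟨h, c, h1, h2⟩ => ⟨h, _, _, _, _, ⟨c, rfl, rfl, rfl, rfl⟩, h1, h2⟩,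
    fun ⟨h, _, _, _, _, ⟨c, h1, _, h2, _⟩, h3, h4⟩ => ⟨h, c, h1 ▸ h3, h2 ▸ h4⟩⟩

theorem Crosses.symm {H H' : X.Hyperplane} (h : Crosses H H') : Crosses H' H := by
  obtain ⟨h0, e, f, g, h, s, h1, h2⟩ := crosses_iff.1 h
  exact crosses_iff.2 ⟨h0.symm, _, _, _, _, s.symm, h2, h1⟩

theorem Parallel.symm {H H' : X.Hyperplane} (h : Parallel H H') : Parallel H' H :=
  ⟨h.1.symm, fun h' => h.2 h'.symm⟩

/-- The carrier of a hyperplane lies on one side of each parallel hyperplane. -/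
theorem Parallel.sameHalfspace {H K : X.Hyperplane} (h : Parallel H K) {e e' : X.Cube 1}
    (he : X.dual e = H) (he' : X.dual e' = H) : SameHalfspace K (X.src e) (X.src e') := by
  have h' := Quot.eqvGen_exact (he.trans he'.symm)
  clear he'
  induction h' with
  | rel _ _ h1 =>
    cases h1 with
    | rev =>
      rw [src_rev]
      exact .of_edge (he ▸ h.1)
    | opposite c =>
      have s : Sq _ _ _ _ := ⟨c, rfl, rfl, rfl, rfl⟩
      rw [s.src_eq, ← s.symm.tgt_eq_src]
      refine .of_edge fun h2 => h.2 (crosses_iff.2 ⟨h.1, _, _, _, _, s, he, h2⟩)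
  | refl => exact .refl _ _
  | symm a b hab ih => exact (ih ((Quot.eqvGen_sound hab).trans he)).symm
  | trans a b c hab _ ih1 ih2 =>
    exact (ih1 he).trans (ih2 ((Quot.eqvGen_sound hab).symm.trans he))

/-- The `0`-cube `x` is an end of a `1`-cube dual to `H`. -/
def Adj (x : X.Cube 0) (H : X.Hyperplane) : Prop := ∃ e, X.src e = x ∧ X.dual e = H

theorem Adj.isClosest {x : X.Cube 0} {H : X.Hyperplane} (h : Adj x H) : IsClosest x H := by
  obtain ⟨e, rfl, he⟩ := h
  rintro ⟨K, hK⟩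
  exact hK e he (.refl _ _)

theorem Parallel.sameHalfspace_of_adj {H K : X.Hyperplane} (h : Parallel H K) {x y : X.Cube 0}
    (hx : Adj x H) (hy : Adj y H) : SameHalfspace K x y := by
  obtain ⟨e, rfl, he⟩ := hx
  obtain ⟨e', rfl, he'⟩ := hy
  exact h.sameHalfspace he he'

/-- Two strips over the same rail: a square spanned by their last rungs is carried back to the first
rungs through a row of `3`-cubes. -/
theorem Ladder.exists_sq (hX : X.NonpositivelyCurved) {a a' c c' : X.Cube 1}
    {m : List (X.Cube 1)} (h : Ladder a m a') (h' : Ladder c m c')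
    (s : ∃ b d, Sq a' b c' d) : ∃ b d, Sq a b c d := by
  induction h generalizing c with
  | nil =>
    cases h'
    exact s
  | cons s1 h ih =>
    cases h' with
    | cons s2 h' =>
      obtain ⟨b, d, s3⟩ := ih h' s
      obtain ⟨a3, b3, c3, o1, -, -⟩ := hX.sq_cube s1.symm.reflect s2.symm.reflect s3
      exact ⟨_, _, o1⟩

namespace IsCAT0

theorem not_mem_ladder (hX : X.IsCAT0) {e e' : X.Cube 1} {m : List (X.Cube 1)}
    (h : Ladder e m e') : X.dual e ∉ m.map X.dual := by
  induction h with
  | nil => simp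
  | cons s _ ih =>
    rw [List.map_cons, List.mem_cons, not_or]
    exact ⟨hX.dual_ne_of_sq s, s.dual_eq ▸ ih⟩

/-- Edges at a `0`-cube that are dual to crossing hyperplanes span a square. -/
theorem exists_sq_of_crosses (hX : X.IsCAT0) {e e' : X.Cube 1} (h : X.src e = X.src e')
    (hc : Crosses (X.dual e) (X.dual e')) : ∃ f f', Sq e f e' f' := by
  obtain ⟨-, a, b, c, d, s, ha, hc⟩ := crosses_iff.1 hc
  -- Reflecting the given square moves its base corner into the quadrant of `X.src e`, one
  -- hyperplane at a time.
  have step : ∀ {a b c d : X.Cube 1} (_ : Sq a b c d) (_ : X.dual a = X.dual e)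
      (_ : X.dual c = X.dual e'), ∃ a b c d, Sq a b c d ∧ X.dual a = X.dual e ∧
        X.dual c = X.dual e' ∧ SameHalfspace (X.dual e) (X.src e) (X.src a) := by
    intro a b c d s ha hc
    by_cases h1 : SameHalfspace (X.dual e) (X.src e) (X.src a)
    · exact ⟨_, _, _, _, s, ha, hc, h1⟩
    · refine ⟨_, _, _, _, s.reflect, by rw [dual_rev, ha], s.symm.dual_eq ▸ hc, ?_⟩
      rw [src_rev]
      exact hX.sameHalfspace_of_separates h1 (ha ▸ hX.separates_dual a)
  obtain ⟨a, b, c, d, s, ha, hc, h1⟩ := step s ha hc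
  have step2 : ∃ a b c d, Sq a b c d ∧ X.dual a = X.dual e ∧ X.dual c = X.dual e' ∧
      SameHalfspace (X.dual e) (X.src e) (X.src a) ∧
      SameHalfspace (X.dual e') (X.src e) (X.src a) := by
    by_cases h2 : SameHalfspace (X.dual e') (X.src e) (X.src a)
    · exact ⟨_, _, _, _, s, ha, hc, h1, h2⟩
    · refine ⟨_, _, _, _, s.symm.reflect.symm, s.dual_eq ▸ ha, by rw [dual_rev, hc], ?_, ?_⟩
      · rw [s.symm.reflect.symm.src_eq, src_rev]
        refine h1.trans ?_
        rw [s.src_eq]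
        exact .of_edge fun h3 => hX.dual_ne_of_sq s (ha.trans h3.symm)
      · rw [s.symm.reflect.symm.src_eq, src_rev]
        refine hX.sameHalfspace_of_separates h2 ?_
        rw [s.src_eq, ← hc]
        exact hX.separates_dual c
  clear h1 s ha hc a b c d
  obtain ⟨a, b, c, d, s, ha, hc, h1, h2⟩ := step2
  obtain ⟨m, hm, hr⟩ := hX.exists_path (X.src e) (X.src a)
  -- Both rungs travel along the same reduced path `m`. A ladder ending at the reversed edge is
  -- excluded: its rail would have to cross its own hyperplane.
  have key : ∀ {e a : X.Cube 1} (_ : X.IsPath (X.src e) m (X.src a)) (_ : X.dual a = X.dual e)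
      (_ : SameHalfspace (X.dual e) (X.src e) (X.src a)), Ladder e m a := by
    intro e a hm ha h1
    rcases exists_ladder ha.symm with ⟨m', h3, h4⟩ | ⟨m', h3, h4⟩
    · exact hX.ladder_of_path h4 h3 hm hr
    · refine absurd h1 fun h5 => hX.not_mem_ladder h4 ?_
      have h6 : Separates (X.dual e) (X.src e) (X.tgt a) :=
        (ha ▸ hX.separates_dual a : Separates (X.dual e) _ _).of_same_left h5.symm
      obtain ⟨f, hf, hd⟩ := h6.exists_edge h3
      exact List.mem_map.2 ⟨f, hf, hd⟩
  refine Ladder.exists_sq hX.nonpositivelyCurved (key hm ha h1) (key (a := c) ?_ hc ?_)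
    ⟨_, _, s⟩
  · rw [← h, ← s.src_eq]; exact hm
  · rw [← h, ← s.src_eq]; exact h2

/-- Distinct `0`-cubes are separated by a hyperplane adjacent to the first. -/
theorem exists_adj_separates (hX : X.IsCAT0) {x y : X.Cube 0} (h : x ≠ y) :
    ∃ H, Adj x H ∧ Separates H x y := by
  obtain ⟨l, h1, h2⟩ := hX.exists_path x y
  match l, h1, h2 with
  | [], h1, _ => exact absurd h1 h
  | e :: l, h1, h2 =>
    exact ⟨X.dual e, ⟨e, h1.1, rfl⟩, (hX.separates_iff h1 h2).2 (by simp)⟩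

/-- Hyperplanes that are adjacent to `x` and separate it from `y` cross. -/
theorem crosses_of_adj_of_separates (hX : X.IsCAT0) {x y : X.Cube 0} {H K : X.Hyperplane}
    (hH : Adj x H) (hK : Adj x K) (sH : Separates H x y) (sK : Separates K x y) (hne : H ≠ K) :
    Crosses H K := by
  by_contra hc
  have hp : Parallel H K := ⟨hne, hc⟩
  obtain ⟨e, rfl, rfl⟩ := hH
  have h1 : SameHalfspace (X.dual e) (X.tgt e) y :=
    hX.sameHalfspace_of_separates (hX.separates_dual e).symm sH
  have h2 : SameHalfspace K (X.src e) (X.tgt e) := by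
    have := hp.sameHalfspace (e := e) (e' := X.rev e) rfl (dual_rev e)
    rwa [src_rev] at this
  obtain ⟨l, hl, hl'⟩ := h1
  have h3 : Separates K (X.tgt e) y := sK.of_same_left h2
  -- The rest of the way to `y` avoids the first hyperplane but crosses `K`, so some edge dual to
  -- `K` lies on the side of `y`. Parallelism puts the whole carrier of `K` on the side of `x`.
  have key : ∀ (l : List (X.Cube 1)) (z : X.Cube 0), X.IsPath z l y →
      (∀ f ∈ l, X.dual f ≠ X.dual e) → Separates K z y → ∃ f, X.dual f = K ∧
        SameHalfspace (X.dual e) (X.src f) y := by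
    intro l
    induction l with
    | nil =>
      intro z hz _ h
      exact absurd (hz ▸ .refl _ _) h
    | cons f l ih =>
      intro z hz h h'
      by_cases hf : X.dual f = K
      · exact ⟨f, hf, f :: l, ⟨rfl, hz.2⟩, h⟩
      · refine ih _ hz.2 (fun g hg => h g (by simp [hg])) (h'.of_same_left ?_)
        rw [← hz.1]
        exact .of_edge hf
  obtain ⟨f, hf, h4⟩ := key l _ hl hl' h3
  obtain ⟨k, hk, hk'⟩ := hK
  refine sH (((hp.symm.sameHalfspace hk' hf).symm.trans ?_).symm.trans h4)
  rw [hk]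
  exact .refl _ _

/-- If each hyperplane that is adjacent to `y` and separates it from `x` crosses `J`, then `y` is
adjacent to `J`. -/
theorem adj_of_crosses (hX : X.IsCAT0) {x : X.Cube 0} {J : X.Hyperplane} (hx : Adj x J)
    {l : List (X.Cube 1)} {y : X.Cube 0} (hl : X.IsPath y l x) (hr : ¬ Reducible l)
    (hJ : SameHalfspace J y x)
    (hc : ∀ K, Adj y K → Separates K y x → K ≠ J → Crosses K J) : Adj y J := by
  induction l generalizing y with
  | nil =>
    cases hl
    exact hx
  | cons k l ih =>
    obtain ⟨rfl, hl2⟩ := hl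
    have hrl : ¬ Reducible l := fun h => hr (h.cons k)
    have hnd := hX.nodup_dual (x := X.src k) (l := k :: l) ⟨rfl, hl2⟩ hr
    have hJl := (hX.sameHalfspace_iff (x := X.src k) (l := k :: l) ⟨rfl, hl2⟩ hr).1 hJ
    rw [List.map_cons, List.nodup_cons] at hnd
    rw [List.map_cons, List.mem_cons, not_or] at hJl
    have hK : Crosses (X.dual k) J := hc _ ⟨k, rfl, rfl⟩
      ((hX.separates_iff (x := X.src k) (l := k :: l) ⟨rfl, hl2⟩ hr).2 (by simp)) (Ne.symm hJl.1)
    have hJ1 : SameHalfspace J (X.tgt k) x := (hX.sameHalfspace_iff hl2 hrl).2 hJl.2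
    have hadj : Adj (X.tgt k) J := by
      refine ih hl2 hrl hJ1 fun L hL sL hLJ => ?_
      have hLk : X.dual k ≠ L := by
        rintro rfl
        exact hnd.1 ((hX.separates_iff hl2 hrl).1 sL)
      have sL' : Separates L (X.src k) x := sL.of_same_left (SameHalfspace.of_edge hLk).symm
      -- If `L` crosses the hyperplane of `k`, a square makes `L` adjacent to `X.src k` and the
      -- hypothesis applies. If not, and `L` does not cross `J` either, then the carriers of `X.dual
      -- k` and `J` each lie on one side of `L`; they share a square, so `L` could not separate
      -- `X.src k` from `x`.
      by_cases hcr : Crosses (X.dual k) L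
      · obtain ⟨e, he, rfl⟩ := hL
        obtain ⟨f, f', s⟩ := hX.exists_sq_of_crosses (e := X.rev k) (e' := e)
          (by rw [src_rev, he]) (by rwa [dual_rev])
        refine hc _ ⟨f, ?_, s.symm.dual_eq.symm⟩ sL' hLJ
        rw [← s.tgt_eq_src, tgt_rev]
      · by_contra hcJ
        obtain ⟨-, a, b, c, d, s, ha, hc'⟩ := crosses_iff.1 hK
        have h1 := Parallel.sameHalfspace ⟨hLk, hcr⟩ rfl ha
        have h2 : SameHalfspace L x (X.src c) := by
          obtain ⟨j, hj, hj'⟩ := hx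
          rw [← hj]
          exact Parallel.sameHalfspace ⟨Ne.symm hLJ, fun h => hcJ h.symm⟩ hj' hc'
        rw [s.src_eq] at h1
        exact sL' (h1.trans h2.symm)
    obtain ⟨j, hj, rfl⟩ := hadj
    obtain ⟨f, f', s⟩ := hX.exists_sq_of_crosses (e := X.rev k) (e' := j)
      (by rw [src_rev, hj]) (by rwa [dual_rev])
    exact ⟨f, by rw [← s.tgt_eq_src, tgt_rev], s.symm.dual_eq.symm⟩

/-- If `J` is adjacent to `x` and not to `y`, and does not separate them, then some parallel
hyperplane adjacent to `y` separates them. -/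
theorem exists_parallel_of_not_adj (hX : X.IsCAT0) {x y : X.Cube 0} {J : X.Hyperplane}
    (hx : Adj x J) (hy : ¬ Adj y J) (hJ : SameHalfspace J x y) :
    ∃ K, Adj y K ∧ Separates K x y ∧ Parallel K J := by
  obtain ⟨l, hl, hr⟩ := hX.exists_path y x
  by_contra! h
  refine hy (hX.adj_of_crosses hx hl hr hJ.symm fun K h1 h2 h3 => ?_)
  by_contra h4
  exact h K h1 h2.symm ⟨h3, h4⟩

/-- In dimension `n` at most `n` pairwise crossing hyperplanes are adjacent to a `0`-cube. -/
theorem length_le_of_pairwise_crosses (hX : X.IsCAT0) {n : ℕ} (hn : X.HasDim n) {x : X.Cube 0}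
    {L : List X.Hyperplane} (hL : L.Pairwise Crosses) (hx : ∀ H ∈ L, Adj x H) :
    L.length ≤ n := by
  have h0 : ∀ i : Fin L.length, ∃ e, X.src e = x ∧ X.dual e = L.get i :=
    fun i => hx _ (List.get_mem L i)
  choose e he hd using h0
  have hcr : ∀ i j : Fin L.length, i ≠ j → Crosses (L.get i) (L.get j) := by
    intro i j hij
    rcases lt_or_gt_of_ne hij with h | h
    · exact List.pairwise_iff_get.1 hL i j h
    · exact (List.pairwise_iff_get.1 hL j i h).symm
  obtain ⟨c, -⟩ := hX.nonpositivelyCurved.link_flag x e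
    (fun i j hij => by
      by_contra h
      exact (hcr i j h).1 (by rw [← hd, ← hd, hij]))
    he (fun i j hij => by
      obtain ⟨f, f', c, h1, -, h2, -⟩ := hX.exists_sq_of_crosses ((he i).trans (he j).symm)
        (by rw [hd, hd]; exact hcr i j hij)
      have h00 : (fun _ => false : Fin 2 → Bool) = ![false, false] := by decide
      exact ⟨c, by rw [h00, ← h1], by rw [h00, ← h2]⟩)
  by_contra h
  exact (hn.2 L.length (by omega)).false c

end IsCAT0

end CubeComplex

namespace CubeComplex

variable {X : CubeComplex.{v}} {G : Type*} [Group G] [CubicalAction G X]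

/-! ### Equivariance -/

instance : MulAction G X.Hyperplane where
  one_smul H := by
    obtain ⟨e, rfl⟩ := Quot.exists_rep H
    exact congrArg X.dual (one_smul G e)
  mul_smul g g' H := by
    obtain ⟨e, rfl⟩ := Quot.exists_rep H
    exact congrArg X.dual (mul_smul g g' e)

theorem src_smul (g : G) (e : X.Cube 1) : X.src (g • e) = g • X.src e :=
  CubicalAction.face_smul _ g e

theorem tgt_smul (g : G) (e : X.Cube 1) : X.tgt (g • e) = g • X.tgt e :=
  CubicalAction.face_smul _ g e

theorem edge_smul {n : ℕ} (g : G) (c : X.Cube n) (a : Fin n → Bool) (i : Fin n) :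
    X.edge (g • c) a i = g • X.edge c a i :=
  CubicalAction.face_smul _ g c

theorem Adj.smul {x : X.Cube 0} {H : X.Hyperplane} (h : Adj x H) (g : G) :
    Adj (g • x) (g • H) := by
  obtain ⟨e, rfl, rfl⟩ := h
  exact ⟨g • e, src_smul g e, rfl⟩

theorem adj_smul_iff {x : X.Cube 0} {H : X.Hyperplane} (g : G) :
    Adj (g • x) (g • H) ↔ Adj x H :=
  ⟨fun h => by simpa using h.smul g⁻¹, fun h => h.smul g⟩

theorem adj_inv_smul_iff {x : X.Cube 0} {H : X.Hyperplane} (g : G) :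
    Adj x (g⁻¹ • H) ↔ Adj (g • x) H := by
  rw [← adj_smul_iff g, smul_inv_smul]

theorem IsPath.smul {x y : X.Cube 0} {l : List (X.Cube 1)} (h : X.IsPath x l y) (g : G) :
    X.IsPath (g • x) (l.map (g • ·)) (g • y) := by
  induction l generalizing x with
  | nil => exact congrArg (g • ·) h
  | cons e l ih =>
    refine ⟨(src_smul g e).trans (congrArg (g • ·) h.1), ?_⟩
    rw [tgt_smul]
    exact ih h.2

theorem SameHalfspace.smul {H : X.Hyperplane} {x y : X.Cube 0} (h : SameHalfspace H x y) (g : G) :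
    SameHalfspace (g • H) (g • x) (g • y) := by
  obtain ⟨l, h1, h2⟩ := h
  refine ⟨_, h1.smul g, fun e he => ?_⟩
  obtain ⟨f, hf, rfl⟩ := List.mem_map.1 he
  exact fun h3 => h2 f hf (MulAction.injective g h3)

theorem sameHalfspace_smul_iff {H : X.Hyperplane} {x y : X.Cube 0} (g : G) :
    SameHalfspace (g • H) (g • x) (g • y) ↔ SameHalfspace H x y :=
  ⟨fun h => by simpa using h.smul g⁻¹, fun h => h.smul g⟩

theorem separates_smul_iff {H : X.Hyperplane} {x y : X.Cube 0} (g : G) :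
    Separates (g • H) (g • x) (g • y) ↔ Separates H x y :=
  not_congr (sameHalfspace_smul_iff g)

theorem Crosses.smul {H K : X.Hyperplane} (h : Crosses H K) (g : G) :
    Crosses (g • H) (g • K) := by
  obtain ⟨h1, c, rfl, rfl⟩ := h
  exact ⟨fun h => h1 (MulAction.injective g h), g • c, by rw [edge_smul]; rfl,
    by rw [edge_smul]; rfl⟩

theorem Parallel.smul {H K : X.Hyperplane} (h : Parallel H K) (g : G) :
    Parallel (g • H) (g • K) :=
  ⟨fun h' => h.1 (MulAction.injective g h'), fun h' => h.2 (by simpa using h'.smul g⁻¹)⟩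

/-! ### Hyperplanes at the basepoint -/

section Alphabet

theorem ncard_exists_mem_list_le {A β : Type*} {r : ℝ} (L : List β) (F : β → Set A)
    (h : ∀ J ∈ L, ((F J).ncard : ℝ) ≤ r) :
    ({t | ∃ J ∈ L, t ∈ F J}.ncard : ℝ) ≤ L.length * r := by
  induction L with
  | nil => simp
  | cons J L ih =>
    have h1 : {t | ∃ J' ∈ J :: L, t ∈ F J'} = F J ∪ {t | ∃ J ∈ L, t ∈ F J} := by
      ext t; simp
    have h2 : ((F J ∪ {t | ∃ J ∈ L, t ∈ F J}).ncard : ℝ) ≤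
        (F J).ncard + {t | ∃ J ∈ L, t ∈ F J}.ncard := by
      exact_mod_cast Set.ncard_union_le _ _
    have h3 := h J (by simp)
    have h4 := ih fun J hJ => h J (by simp [hJ])
    rw [h1, List.length_cons]
    push_cast
    linarith

variable {A : Type*} (γ : A → G) (x : X.Cube 0)

/-- The hyperplanes adjacent to `x` that separate `x` from its translate by the letter `t`. -/
def initialHyperplanes (t : A) : Set X.Hyperplane := {K | Adj x K ∧ Separates K x (γ t • x)}

/-- The hyperplanes adjacent to `x` that separate `x` from its translate by some letter in `T`. -/
def visibleBy (T : Set A) : Set X.Hyperplane := {K | ∃ t ∈ T, K ∈ initialHyperplanes γ x t}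

/-- The letters of `T` that move `x` across `H`. -/
def crossing (T : Set A) (H : X.Hyperplane) : Set A := {t | t ∈ T ∧ Separates H x (γ t • x)}

/-- The letters that do not move `x` across `J` but move `x` away from `J`. -/
def leaving (T : Set A) (J : X.Hyperplane) : Set A :=
  {t | t ∈ T ∧ SameHalfspace J x (γ t • x) ∧ ¬ Adj (γ t • x) J}

variable {γ x}

/-- A letter with an initial hyperplane not crossing `H` must cross or leave `H`. If both kinds are
rare for some visible `H`, discarding these letters and their inverses costs at most `μ`, and all
later choices of `H` cross this one. The dimension allows at most `n` such rounds. -/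
theorem exists_alphabet (hX : X.IsCAT0) {n : ℕ} (hn : X.HasDim n) [Finite A] (ι : A → A)
    (hι : ∀ t, ι (ι t) = t) {μ : ℝ} (hμ : 0 ≤ μ) :
    ∃ T : Set A, (∀ t ∈ T, ι t ∈ T) ∧ (Tᶜ.ncard : ℝ) ≤ n * μ ∧
      ∀ H ∈ visibleBy γ x T, μ / 4 ≤ ((crossing γ x T H).ncard : ℝ) ∨
        μ / 4 ≤ ((leaving γ x T H).ncard : ℝ) := by
  classical
  by_contra! hcon
  let T : List X.Hyperplane → Set A := fun L =>
    {t | ∀ H ∈ L, ∀ K ∈ initialHyperplanes γ x t ∪ initialHyperplanes γ x (ι t), Crosses K H}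
  have hT : ∀ L, ∀ t ∈ T L, ι t ∈ T L := by
    intro L t ht H hH K hK
    refine ht H hH K ?_
    rw [hι] at hK
    exact hK.symm
  have main : ∀ m : ℕ, ∃ L : List X.Hyperplane, L.length = m ∧ L.Pairwise Crosses ∧
      (∀ H ∈ L, Adj x H) ∧ ((T L)ᶜ.ncard : ℝ) ≤ m * μ := by
    intro m
    induction m with
    | zero =>
      refine ⟨[], rfl, .nil, by simp, ?_⟩
      have : (T [])ᶜ = ∅ := by ext; simp [T]
      simp [this]
    | succ m ih =>
      obtain ⟨L, rfl, hL1, hL2, hL3⟩ := ih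
      have hlen := hX.length_le_of_pairwise_crosses hn hL1 hL2
      obtain ⟨H, ⟨t, ht, hH⟩, h1, h2⟩ := hcon (T L) (hT L) (hL3.trans (by gcongr))
      refine ⟨H :: L, rfl, List.pairwise_cons.2 ⟨fun H' hH' => ht H' hH' H (.inl hH), hL1⟩,
        by simpa using ⟨hH.1, hL2⟩, ?_⟩
      -- Crossing and leaving letters contribute less than `μ / 4` each; closing under `ι` doubles
      -- the bound `μ / 2` to `μ`.
      let P : Set A := {s | s ∈ T L ∧ ∃ K ∈ initialHyperplanes γ x s, ¬ Crosses K H}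
      have hP : (P.ncard : ℝ) ≤ μ / 2 := by
        have hsub : P ⊆ crossing γ x (T L) H ∪ leaving γ x (T L) H := by
          rintro s ⟨hs, K, hK, hKH⟩
          by_cases hsame : SameHalfspace H x (γ s • x)
          · refine .inr ⟨hs, hsame, fun hadj => ?_⟩
            have hne : H ≠ K := by
              rintro rfl
              exact hK.2 hsame
            exact hK.2 (Parallel.sameHalfspace_of_adj ⟨hne, fun h => hKH h.symm⟩ hH.1 hadj)
          · exact .inl ⟨hs, hsame⟩
        have h3 := (Set.ncard_le_ncard hsub (Set.toFinite _)).trans (Set.ncard_union_le _ _)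
        have h4 : (P.ncard : ℝ) ≤ (crossing γ x (T L) H).ncard + (leaving γ x (T L) H).ncard := by
          exact_mod_cast h3
        linarith
      have hsub : (T (H :: L))ᶜ ⊆ (T L)ᶜ ∪ (P ∪ ι '' P) := by
        intro s hs
        by_cases hsL : s ∈ T L
        · refine .inr ?_
          simp only [T, List.mem_cons, Set.mem_compl_iff, Set.mem_ofPred_eq, not_forall] at hs
          obtain ⟨H', hH', K, hK, hc⟩ := hs
          rcases hH' with rfl | hH'
          · rcases hK with hK | hK
            · exact .inl ⟨hsL, K, hK, hc⟩
            · exact .inr ⟨ι s, ⟨hT L s hsL, K, hK, hc⟩, hι s⟩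
          · exact absurd (hsL H' hH' K hK) hc
        · exact .inl hsL
      have h3 := (Set.ncard_le_ncard hsub (Set.toFinite _)).trans ((Set.ncard_union_le _ _).trans
        (Nat.add_le_add_left ((Set.ncard_union_le _ _).trans
          (Nat.add_le_add_left (Set.ncard_image_le (Set.toFinite P)) _)) _))
      have h4 : ((T (H :: L))ᶜ.ncard : ℝ) ≤ (T L)ᶜ.ncard + (P.ncard + P.ncard) := by
        exact_mod_cast h3
      push_cast
      linarith
  obtain ⟨L, h1, h2, h3, -⟩ := main (n + 1)
  have := hX.length_le_of_pairwise_crosses hn h2 h3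
  omega

variable (γ x) in
/-- `J` is good if at least `r` letters of `T` do not move `x` across `J` and either carry `J` to
a visible hyperplane, or move `x` away from `J`, or carry `J` to a hyperplane that is good with one
step less. -/
def IsGood (T : Set A) (r : ℝ) : ℕ → X.Hyperplane → Prop
  | 0, _ => False
  | m + 1, J => r ≤ ({t | t ∈ T ∧ SameHalfspace J x (γ t • x) ∧ ((γ t)⁻¹ • J ∈ visibleBy γ x T ∨
      ¬ Adj (γ t • x) J ∨ IsGood T r m ((γ t)⁻¹ • J))}.ncard : ℝ)

variable [Finite A] {T : Set A} {r : ℝ}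

theorem IsGood.succ {m : ℕ} {J : X.Hyperplane} (h : IsGood γ x T r m J) :
    IsGood γ x T r (m + 1) J := by
  induction m generalizing J with
  | zero => exact h.elim
  | succ m ih =>
    refine le_trans h (Nat.cast_le.2 (Set.ncard_le_ncard ?_ (Set.toFinite _)))
    exact fun t ht => ⟨ht.1, ht.2.1, ht.2.2.imp_right (Or.imp_right ih)⟩

theorem IsGood.mono {m k : ℕ} (hmk : m ≤ k) {J : X.Hyperplane} (h : IsGood γ x T r m J) :
    IsGood γ x T r k J := by
  induction hmk with
  | refl => exact h
  | step _ ih => exact ih.succ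

theorem isGood_of_le_ncard_leaving {m : ℕ} (hm : 0 < m) {J : X.Hyperplane}
    (h : r ≤ ((leaving γ x T J).ncard : ℝ)) : IsGood γ x T r m J := by
  obtain ⟨k, rfl⟩ := Nat.exists_eq_succ_of_ne_zero hm.ne'
  refine le_trans h (Nat.cast_le.2 (Set.ncard_le_ncard ?_ (Set.toFinite _)))
  exact fun t ht => ⟨ht.1, ht.2.1, .inr (.inl ht.2.2)⟩

/-- If `H` were not good, a family of `m` crossing hyperplanes at `x`, neither visible nor good at
level `n - m`, could be enlarged by `H` and moved by an inverse letter to such a family of `m + 1`.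
The bound `hcount` leaves a suitable letter as long as the enlarged family has at most `n` members.
-/
theorem isGood_of_mem_visibleBy (hX : X.IsCAT0) {n : ℕ} (hn : X.HasDim n)
    (hmove : ∀ t, γ t • x ≠ x)
    (hT : ∀ H ∈ visibleBy γ x T, r ≤ ((crossing γ x T H).ncard : ℝ) ∨
        r ≤ ((leaving γ x T H).ncard : ℝ))
    (hr : 0 ≤ r)
    (hcount : ∀ H ∈ visibleBy γ x T,
      (Tᶜ.ncard : ℝ) + (crossing γ x T H).ncard + n * r < Nat.card A)
    {H : X.Hyperplane} (hH : H ∈ visibleBy γ x T) : IsGood γ x T r n H := by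
  by_contra hbad
  have hHx : Adj x H := by
    obtain ⟨t, -, h, -⟩ := hH
    exact h
  have hn0 : 0 < n := hX.length_le_of_pairwise_crosses hn (L := [H]) (by simp) (by simpa using hHx)
  have hlarge := (hT H hH).resolve_right fun h => hbad (isGood_of_le_ncard_leaving hn0 h)
  have same_of_notMem : ∀ {J : X.Hyperplane} {t : A}, Adj x J → J ∉ visibleBy γ x T → t ∈ T →
      SameHalfspace J x (γ t • x) := by
    intro J t h1 h2 h3
    by_contra h4
    exact h2 ⟨t, h3, h1, h4⟩
  have step : ∀ m < n, ∀ L : List X.Hyperplane, L.length = m → L.Pairwise Crosses →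
      (∀ J ∈ L, Adj x J ∧ J ∉ visibleBy γ x T ∧ ¬ IsGood γ x T r (n - m) J) →
      (H :: L).Pairwise Crosses ∧ ∃ t ∈ T, ∀ J ∈ H :: L, Adj x J ∧ SameHalfspace J x (γ t • x) ∧
        Adj (γ t • x) J ∧ (γ t)⁻¹ • J ∉ visibleBy γ x T ∧
        ¬ IsGood γ x T r (n - (m + 1)) ((γ t)⁻¹ • J) := by
    intro m hm L hlen hpw hL
    obtain ⟨k, hk⟩ : ∃ k, n - m = k + 1 := ⟨n - m - 1, by omega⟩
    have hk' : n - (m + 1) = k := by omega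
    rw [hk] at hL
    rw [hk']
    refine ⟨List.pairwise_cons.2 ⟨fun J hJ => ?_, hpw⟩, ?_⟩
    · obtain ⟨h1, h2, h3⟩ := hL J hJ
      -- No letter of `T` crosses the invisible `J`. Were `J` parallel to `H`, each of the many
      -- letters crossing `H` would leave `J`, making `J` good.
      by_contra hc
      have hp : Parallel J H := ⟨fun h => h2 (h ▸ hH), fun h => hc h.symm⟩
      refine h3 (isGood_of_le_ncard_leaving (Nat.succ_pos k) 
        (hlarge.trans (Nat.cast_le.2 (Set.ncard_le_ncard ?_ (Set.toFinite _)))))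
      exact fun t ht => ⟨ht.1, same_of_notMem h1 h2 ht.1,
        fun h => ht.2 (hp.sameHalfspace_of_adj h1 h)⟩
    · let F : X.Hyperplane → Set A := fun J => {t | t ∈ T ∧ SameHalfspace J x (γ t • x) ∧
        ((γ t)⁻¹ • J ∈ visibleBy γ x T ∨ ¬ Adj (γ t • x) J ∨ IsGood γ x T r k ((γ t)⁻¹ • J))}
      have hF : ∀ J ∈ H :: L, ((F J).ncard : ℝ) ≤ r := by
        intro J hJ
        have : ¬ IsGood γ x T r (k + 1) J := by
          rcases List.mem_cons.1 hJ with rfl | hJ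
          · exact fun h => hbad (h.mono (by omega))
          · exact (hL J hJ).2.2
        exact (not_le.1 this).le
      have h1 := ncard_exists_mem_list_le _ F hF
      -- Such a letter keeps `x` adjacent to and on its side of every member of `H :: L`, while the
      -- translates by its inverse are neither visible nor good one level lower.
      obtain ⟨t, ht⟩ : ∃ t, t ∉ (Tᶜ ∪ crossing γ x T H) ∪ {t | ∃ J ∈ H :: L, t ∈ F J} := by
        by_contra! hall
        have h2 : Nat.card A ≤ Tᶜ.ncard + (crossing γ x T H).ncard +
            {t | ∃ J ∈ H :: L, t ∈ F J}.ncard := by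
          rw [← Set.ncard_univ, ← Set.eq_univ_of_forall hall]
          exact (Set.ncard_union_le _ _).trans (Nat.add_le_add_right (Set.ncard_union_le _ _) _)
        have h3 : (Nat.card A : ℝ) ≤ Tᶜ.ncard + (crossing γ x T H).ncard +
            {t | ∃ J ∈ H :: L, t ∈ F J}.ncard := by exact_mod_cast h2
        have h4 : (((H :: L).length : ℕ) : ℝ) * r ≤ n * r := by
          gcongr
          simp [hlen]
          omega
        linarith [hcount H hH]
      simp only [Set.mem_union, not_or, Set.mem_compl_iff, not_not] at ht
      obtain ⟨⟨htT, htH⟩, htF⟩ := ht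
      refine ⟨t, htT, fun J hJ => ?_⟩
      have hadj : Adj x J := by
        rcases List.mem_cons.1 hJ with rfl | hJ
        · exact hHx
        · exact (hL J hJ).1
      have hsame : SameHalfspace J x (γ t • x) := by
        rcases List.mem_cons.1 hJ with rfl | hJ
        · by_contra h
          exact htH ⟨htT, h⟩
        · exact same_of_notMem hadj (hL J hJ).2.1 htT
      have hJF : t ∉ F J := fun h => htF ⟨J, hJ, h⟩
      have h5 : ¬ ((γ t)⁻¹ • J ∈ visibleBy γ x T ∨ ¬ Adj (γ t • x) J ∨
          IsGood γ x T r k ((γ t)⁻¹ • J)) := fun h => hJF ⟨htT, hsame, h⟩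
      simp only [not_or, not_not] at h5
      exact ⟨hadj, hsame, h5.2.1, h5.1, h5.2.2⟩
  have main : ∀ m < n, ∃ L : List X.Hyperplane, L.length = m ∧ L.Pairwise Crosses ∧
      ∀ J ∈ L, Adj x J ∧ J ∉ visibleBy γ x T ∧ ¬ IsGood γ x T r (n - m) J := by
    intro m
    induction m with
    | zero => exact fun _ => ⟨[], rfl, .nil, by simp⟩
    | succ m ih =>
      intro hm
      obtain ⟨L, h1, h2, h3⟩ := ih (by omega)
      obtain ⟨h4, t, -, h5⟩ := step m (by omega) L h1 h2 h3
      refine ⟨(H :: L).map ((γ t)⁻¹ • ·), by simp [h1],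
        List.pairwise_map.2 (h4.imp fun h => h.smul _), fun J hJ => ?_⟩
      obtain ⟨J', hJ', rfl⟩ := List.mem_map.1 hJ
      obtain ⟨-, -, h6, h7, h8⟩ := h5 J' hJ'
      exact ⟨(adj_inv_smul_iff _).2 h6, h7, h8⟩
  obtain ⟨L, h1, h2, h3⟩ := main (n - 1) (by omega)
  obtain ⟨h4, t, -, h5⟩ := step (n - 1) (by omega) L h1 h2 h3
  -- `x` and its translate are both adjacent to all `n` members and on the same side of each, so a
  -- hyperplane at `x` separating them crosses every member. That makes `n + 1`.
  obtain ⟨K, hK, sK⟩ := hX.exists_adj_separates (hmove t).symm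
  have h6 : ∀ J ∈ H :: L, Crosses K J := by
    intro J hJ
    obtain ⟨h7, h8, h9, -⟩ := h5 J hJ
    by_contra hc
    have hne : J ≠ K := by
      rintro rfl
      exact sK h8
    exact sK (Parallel.sameHalfspace_of_adj ⟨hne, fun h => hc h.symm⟩ h7 h9)
  have h7 : ∀ J ∈ K :: H :: L, Adj x J := by
    intro J hJ
    rcases List.mem_cons.1 hJ with rfl | hJ
    · exact hK
    · exact (h5 J hJ).1
  have h8 := hX.length_le_of_pairwise_crosses hn (List.pairwise_cons.2 ⟨h6, h4⟩) h7
  simp [h1] at h8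
  omega

end Alphabet

end CubeComplex

/-! ### Counting, and automata from relations. -/

theorem ncard_exists_mem_le {A β : Type*} [Finite A] (F : A → Set β) {k : ℕ}
    (h : ∀ t, (F t).Finite ∧ (F t).ncard ≤ k) :
    {b | ∃ t, b ∈ F t}.Finite ∧ {b | ∃ t, b ∈ F t}.ncard ≤ Nat.card A * k := by
  classical
  have := Fintype.ofFinite A
  have h1 : {b | ∃ t, b ∈ F t} =
      ((Finset.univ.biUnion fun t => (h t).1.toFinset : Finset β) : Set β) := by
    ext b; simp
  rw [h1]
  refine ⟨Finset.finite_toSet _, ?_⟩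
  rw [Set.ncard_coe_finset, Nat.card_eq_fintype_card]
  refine Finset.card_biUnion_le_card_mul _ _ _ fun t _ => ?_
  rw [← Set.ncard_eq_toFinset_card _ (h t).1]
  exact (h t).2

theorem one_add_sum_pow_le (b n : ℕ) : 1 + ∑ j ∈ Finset.range n, b ^ (j + 1) ≤ (b + 1) ^ n := by
  induction n with
  | zero => simp
  | succ n ih =>
    rw [Finset.sum_range_succ, pow_succ (b + 1)]
    have : b ^ (n + 1) ≤ (b + 1) ^ n * b := by
      rw [pow_succ]
      gcongr
      omega
    linarith

/-- Realization of a finite transition relation by a deterministically labeled automaton. -/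
theorem Automaton.exists_of_relation {W A : Type*} [Finite W] [Finite A] (w₀ : W)
    (R : W → A → W → Prop) :
    ∃ (M : Automaton A) (st : M.V ≃ W), st M.start = w₀ ∧ M.Deterministic ∧
      (∀ e, R (st (M.src e)) (M.label e) (st (M.tgt e))) ∧
      ∀ q t, (∃ w, R (st q) t w) → ∃ e, M.src e = q ∧ M.label e = t := by
  let φ := Finite.equivFin W
  let ψ := Finite.equivFin A
  let M : Automaton A :=
    { V := Fin (Nat.card W)
      -- One edge for each pair of state and letter that admits a successor, with a chosen target;
      -- this makes the labeling deterministic.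
      E := {p : Fin (Nat.card W) × Fin (Nat.card A) // ∃ w, R (φ.symm p.1) (ψ.symm p.2) w}
      finite_V := inferInstance
      finite_E := inferInstance
      src := fun e => e.1.1
      tgt := fun e => φ e.2.choose
      label := fun e => ψ.symm e.1.2
      start := φ w₀ }
  refine ⟨M, φ.symm, φ.symm_apply_apply w₀, ?_, ?_, ?_⟩
  · intro e f h1 h2
    exact Subtype.ext (Prod.ext h1 (ψ.symm.injective h2))
  · intro e
    have := e.2.choose_spec
    simpa [M] using this
  · rintro q t ⟨w, hw⟩
    exact ⟨⟨(q, ψ t), w, by simpa using hw⟩, rfl, ψ.symm_apply_apply t⟩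

/-! ### States and transitions of the automaton. -/

namespace CubeComplex

variable {X : CubeComplex.{v}}

theorem IsCAT0.ncard_le_of_pairwise_crosses (hX : X.IsCAT0) {n : ℕ} (hn : X.HasDim n)
    {x : X.Cube 0} {s : Set X.Hyperplane} (hs : s.Pairwise Crosses) (hx : ∀ H ∈ s, Adj x H) :
    s.Finite ∧ s.ncard ≤ n := by
  have key : ∀ F : Finset X.Hyperplane, (F : Set X.Hyperplane) ⊆ s → F.card ≤ n := by
    intro F hF
    rw [← Finset.length_toList]
    refine hX.length_le_of_pairwise_crosses hn ?_ fun H hH => hx H (hF (Finset.mem_toList.1 hH))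
    refine (Finset.nodup_toList F).imp_of_mem fun ha hb hab => ?_
    exact hs (hF (Finset.mem_toList.1 ha)) (hF (Finset.mem_toList.1 hb)) hab
  have hfin : s.Finite := by
    by_contra h
    obtain ⟨F, h1, h2⟩ := Set.Infinite.exists_subset_card_eq h (n + 1)
    have := key F h1
    omega
  refine ⟨hfin, ?_⟩
  rw [Set.ncard_eq_toFinset_card s hfin]
  exact key _ (by simp)

/-- A path from `x` to `z` must cross `H`. At that edge it is on the side of `H'` that contains `y`,
so it still has to cross `H'`. -/
theorem Parallel.separates_of_separates {H H' : X.Hyperplane} (hp : Parallel H H')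
    {x y z : X.Cube 0} (hy : Adj y H) (hs : Separates H x y) (hz : SameHalfspace H y z)
    (hs' : Separates H' y z) : Separates H' x z := by
  rintro ⟨l, h1, h2⟩
  obtain ⟨e, he, hd⟩ := (hs.of_same_right hz).exists_edge h1
  obtain ⟨p, q, rfl⟩ := List.append_of_mem he
  obtain ⟨w, -, h3, h4⟩ := isPath_append.1 h1
  refine hs' ((hp.sameHalfspace_of_adj hy ⟨e, h3, hd⟩).trans ⟨e :: q, isPath_cons.2 ⟨h3, h4⟩, ?_⟩)
  · exact fun f hf => h2 f (by simp [List.mem_cons.1 hf])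

variable {G : Type*} [Group G] [CubicalAction G X] {A : Type*}

/-- The hyperplanes that are carried to a hyperplane in `V` by a word of length `j`. -/
def inverseTranslates (γ : A → G) (V : Set X.Hyperplane) : ℕ → Set X.Hyperplane
  | 0 => V
  | j + 1 => {K | ∃ t, K ∈ ((γ t)⁻¹ • ·) '' inverseTranslates γ V j}

variable {γ : A → G} {x : X.Cube 0}

theorem ncard_inverseTranslates_le [Finite A] {V : Set X.Hyperplane} {k : ℕ} (hV : V.Finite)
    (hk : V.ncard ≤ k) (j : ℕ) : (inverseTranslates γ V j).Finite ∧
      (inverseTranslates γ V j).ncard ≤ Nat.card A ^ j * k := by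
  induction j with
  | zero => exact ⟨hV, by simpa [inverseTranslates] using hk⟩
  | succ j ih =>
    have := ncard_exists_mem_le (fun t => ((γ t)⁻¹ • ·) '' inverseTranslates γ V j)
      (k := Nat.card A ^ j * k) fun t => ⟨ih.1.image _, (Set.ncard_image_le ih.1).trans ih.2⟩
    rw [pow_succ']
    rwa [mul_assoc]

/-- The initial hyperplanes of one letter cross pairwise, so each letter contributes at most `n`. -/
theorem IsCAT0.ncard_visibleBy_le [Finite A] (hX : X.IsCAT0) {n : ℕ} (hn : X.HasDim n)
    (T : Set A) : (visibleBy γ x T).Finite ∧ (visibleBy γ x T).ncard ≤ Nat.card A * n := by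
  have h1 := ncard_exists_mem_le (initialHyperplanes γ x) (k := n) fun t =>
    hX.ncard_le_of_pairwise_crosses hn (x := x)
      (fun H hH K hK hne => hX.crosses_of_adj_of_separates hH.1 hK.1 hH.2 hK.2 hne)
      (fun H hH => hH.1)
  have h2 : visibleBy γ x T ⊆ {b | ∃ t, b ∈ initialHyperplanes γ x t} :=
    fun K ⟨t, _, h⟩ => ⟨t, h⟩
  exact ⟨h1.1.subset h2, (Set.ncard_le_ncard h2 h1.1).trans h1.2⟩

variable (γ x) in
/-- The hyperplanes that are followed by the automaton. -/
def states (T : Set A) (r : ℝ) (n : ℕ) : Set X.Hyperplane :=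
  {J | Adj x J ∧ ∃ j < n, J ∈ inverseTranslates γ (visibleBy γ x T) j ∧
    IsGood γ x T r (n - j) J}

theorem IsCAT0.ncard_states_le [Finite A] (hX : X.IsCAT0) {n : ℕ} (hn : X.HasDim n) (hn0 : 0 < n)
    (T : Set A) (r : ℝ) :
    (states γ x T r n).Finite ∧ 1 + (states γ x T r n).ncard ≤ (Nat.card A * n + 1) ^ n := by
  classical
  have h1 := hX.ncard_visibleBy_le (γ := γ) (x := x) hn T
  have h2 := fun j => ncard_inverseTranslates_le (γ := γ) h1.1 h1.2 j
  have hsub : states γ x T r n ⊆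
      ((Finset.range n).biUnion fun j => (h2 j).1.toFinset : Finset X.Hyperplane) := by
    rintro J ⟨-, j, hj, hJ, -⟩
    simp only [Finset.coe_biUnion, Set.mem_iUnion]
    exact ⟨j, by simpa using hj, by simpa using hJ⟩
  refine ⟨(Finset.finite_toSet _).subset hsub, ?_⟩
  refine le_trans (Nat.add_le_add_left ?_ 1) (one_add_sum_pow_le (Nat.card A * n) n)
  refine (Set.ncard_le_ncard hsub (Finset.finite_toSet _)).trans ?_
  rw [Set.ncard_coe_finset]
  refine Finset.card_biUnion_le.trans (Finset.sum_le_sum fun j _ => ?_)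
  rw [← Set.ncard_eq_toFinset_card _ (h2 j).1]
  refine (h2 j).2.trans ?_
  rw [pow_succ]
  gcongr
  exact Nat.le_mul_of_pos_right _ hn0

variable (γ x) in
/-- The transitions of the automaton: from the start, the letter `t` leads to a visible hyperplane
whose translate separates `x` and `t x`; from `J` it leads to `t⁻¹ J` if that is adjacent to `x`,
and to a visible hyperplane with a translate parallel to `J` otherwise. -/
def Transition (T : Set A) : Option X.Hyperplane → A → Option X.Hyperplane → Prop
  | none, t, some K => K ∈ visibleBy γ x T ∧ Separates (γ t • K) x (γ t • x)
  | some J, t, some K => SameHalfspace J x (γ t • x) ∧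
      ((K = (γ t)⁻¹ • J ∧ Adj (γ t • x) J) ∨
        (K ∈ visibleBy γ x T ∧ Parallel (γ t • K) J ∧ Separates (γ t • K) x (γ t • x)))
  | _, _, none => False

/-- Apply `exists_adj_separates` to the inverse letter and translate by `t`; the result is visible
by `T` because `T` is closed under inverses. -/
theorem exists_transition_none (hX : X.IsCAT0) {T : Set A} {ι : A → A}
    (hι : ∀ t, γ (ι t) = (γ t)⁻¹) (hT : ∀ t ∈ T, ι t ∈ T) (hmove : ∀ t, γ t • x ≠ x) {t : A}
    (ht : t ∈ T) : ∃ K ∈ visibleBy γ x T, Transition γ x T none t (some K) := by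
  obtain ⟨K, hK, sK⟩ := hX.exists_adj_separates (hmove (ι t)).symm
  have hKv : K ∈ visibleBy γ x T := ⟨_, hT t ht, hK, sK⟩
  refine ⟨K, hKv, hKv, ?_⟩
  rw [hι, ← separates_smul_iff (γ t), smul_inv_smul] at sK
  exact sK.symm

/-- The letters counted by goodness all have successors: a visible translate restarts at level `n`,
a good one goes down a level, and a letter leaving `J` passes to a parallel visible hyperplane. -/
theorem exists_transition_some [Finite A] (hX : X.IsCAT0) {n : ℕ} {T : Set A} {r : ℝ} {ι : A → A}
    (hι : ∀ t, γ (ι t) = (γ t)⁻¹) (hT : ∀ t ∈ T, ι t ∈ T)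
    (hvis : visibleBy γ x T ⊆ states γ x T r n) {J : X.Hyperplane} (hJ : J ∈ states γ x T r n) :
    r ≤ ({t | ∃ K ∈ states γ x T r n, Transition γ x T (some J) t (some K)}.ncard : ℝ) := by
  obtain ⟨hadj, j, hj, hJj, hgood⟩ := hJ
  obtain ⟨k, hk⟩ : ∃ k, n - j = k + 1 := ⟨n - j - 1, by omega⟩
  rw [hk] at hgood
  refine le_trans hgood (Nat.cast_le.2 (Set.ncard_le_ncard ?_ (Set.toFinite _)))
  rintro t ⟨htT, hsame, h⟩
  by_cases hadj' : Adj (γ t • x) J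
  · refine ⟨(γ t)⁻¹ • J, ?_, hsame, .inl ⟨rfl, hadj'⟩⟩
    rcases h with h | h | h
    · exact hvis h
    · exact absurd hadj' h
    · refine ⟨(adj_inv_smul_iff _).2 hadj', j + 1, ?_, ⟨t, J, hJj, rfl⟩, ?_⟩
      · by_contra hlt
        obtain rfl : k = 0 := by omega
        exact h
      · rwa [show n - (j + 1) = k by omega]
  · obtain ⟨K, h1, h2, h3⟩ := hX.exists_parallel_of_not_adj hadj hadj' hsame
    have h4 : (γ t)⁻¹ • K ∈ visibleBy γ x T := by
      refine ⟨ι t, hT t htT, (adj_inv_smul_iff _).2 h1, ?_⟩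
      rw [hι, ← separates_smul_iff (γ t), smul_inv_smul, smul_inv_smul]
      exact h2.symm
    exact ⟨_, hvis h4, hsame, .inr ⟨h4, by rwa [smul_inv_smul], by rwa [smul_inv_smul]⟩⟩

end CubeComplex

/-! ### Progress along paths of the automaton. -/

namespace Automaton

open CubeComplex

variable {S : Type u} {X : CubeComplex.{v}} [CubicalAction (FreeGroup S) X]

theorem word_concat {A : Type*} (M : Automaton A) (l : List M.E) (e : M.E) :
    M.word (l ++ [e]) = M.word l ++ [M.label e] := by
  simp [word]

theorem isPath_concat {A : Type*} {M : Automaton A} {p q : M.V} {l : List M.E} {e : M.E} :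
    M.IsPath p (l ++ [e]) q ↔ M.IsPath p l (M.src e) ∧ M.tgt e = q := by
  rw [IsPath, isEdgePath_append]
  constructor
  · rintro ⟨z, h1, h2, h3⟩
    exact ⟨h2 ▸ h1, h3⟩
  · rintro ⟨h1, h2⟩
    exact ⟨_, h1, rfl, h2⟩

theorem mk_append_smul {α : Type*} [MulAction (FreeGroup S) α] (w : List (S × Bool))
    (t : S × Bool) (a : α) :
    FreeGroup.mk (w ++ [t]) • a = FreeGroup.mk w • FreeGroup.mk [t] • a := by
  rw [smul_smul, FreeGroup.mul_mk]

theorem mk_nil_smul {α : Type*} [MulAction (FreeGroup S) α] (a : α) :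
    FreeGroup.mk ([] : List (S × Bool)) • a = a := by
  rw [← FreeGroup.one_eq_mk, one_smul]

variable {M : Automaton (S × Bool)} {x : X.Cube 0} {T : Set (S × Bool)}
  {st : M.V → Option X.Hyperplane}

/-- Along a path from the start, the translate of the current hyperplane separates `x` from its
translate by the label. -/
theorem separates_of_isPath (hst : st M.start = none)
    (hM : ∀ e, Transition (fun t => FreeGroup.mk [t]) x T (st (M.src e)) (M.label e)
      (st (M.tgt e))) {l : List M.E} (hl : l ≠ []) {q : M.V} (hp : M.IsPath M.start l q) :
    ∃ K, st q = some K ∧ Adj x K ∧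
      Separates (FreeGroup.mk (M.word l) • K) x (FreeGroup.mk (M.word l) • x) := by
  induction l using List.reverseRecOn generalizing q with
  | nil => exact absurd rfl hl
  | append_singleton l e ih =>
    obtain ⟨h1, rfl⟩ := isPath_concat.1 hp
    have hE := hM e
    cases hK : st (M.tgt e) with
    | none => rw [hK] at hE; cases h : st (M.src e) <;> rw [h] at hE <;> exact hE.elim
    | some K =>
    refine ⟨K, rfl, ?_⟩
    rw [hK] at hE
    rw [word_concat, mk_append_smul, mk_append_smul]
    rcases eq_or_ne l [] with rfl | hne
    · have h2 : M.src e = M.start := Eq.symm h1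
      rw [h2, hst] at hE
      obtain ⟨⟨_, _, h, _⟩, hs⟩ := hE
      exact ⟨h, by simpa [word, mk_nil_smul] using hs⟩
    · obtain ⟨J, hJ, hadj, hs⟩ := ih hne h1
      rw [hJ] at hE
      obtain ⟨hsame, ⟨rfl, h2⟩ | ⟨⟨_, _, h, _⟩, h3, h4⟩⟩ := hE
      · refine ⟨(adj_inv_smul_iff _).2 h2, ?_⟩
        rw [smul_inv_smul]
        exact hs.of_same_right (hsame.smul _)
      · exact ⟨h, (h3.symm.smul _).separates_of_separates (hadj.smul _) hs (hsame.smul _)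
          ((separates_smul_iff _).2 h4)⟩

/-- Along a path that meets a visible hyperplane `J` at its initial vertex only, `x` stays in its
halfspace of `J`. -/
theorem sameHalfspace_of_isPath
    (hM : ∀ e, Transition (fun t => FreeGroup.mk [t]) x T (st (M.src e)) (M.label e)
      (st (M.tgt e))) {c : M.V} {J : X.Hyperplane} (hc : st c = some J) (hJ : Adj x J)
    {l : List M.E} {q : M.V} (hp : M.IsPath c l q)
    (hl : ∀ e ∈ l.tail, ∀ K ∈ visibleBy (fun t => FreeGroup.mk [t]) x T,
      st (M.src e) ≠ some K) :
    SameHalfspace J x (FreeGroup.mk (M.word l) • x) ∧ ∃ K, st q = some K ∧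
      ((FreeGroup.mk (M.word l) • K = J ∧ Adj (FreeGroup.mk (M.word l) • x) J) ∨
        (K ∈ visibleBy (fun t => FreeGroup.mk [t]) x T ∧
          Parallel (FreeGroup.mk (M.word l) • K) J ∧
          Separates (FreeGroup.mk (M.word l) • K) x (FreeGroup.mk (M.word l) • x))) := by
  induction l using List.reverseRecOn generalizing q with
  | nil =>
    obtain rfl : c = q := hp
    have h0 : M.word [] = [] := rfl
    rw [h0, mk_nil_smul]
    exact ⟨.refl _ _, J, hc, .inl ⟨mk_nil_smul J, hJ⟩⟩
  | append_singleton l e ih =>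
    obtain ⟨h1, rfl⟩ := isPath_concat.1 hp
    have hE := hM e
    obtain ⟨h2, K, hK, h3⟩ := ih h1 fun f hf => hl f (by
      cases l with
      | nil => simp at hf
      | cons a l => simpa using .inl hf)
    -- Before the last edge the automaton is still following `J`: a switch would have put a visible
    -- hyperplane at an intermediate vertex, and for empty `l` the vertex is `c` itself.
    have h4 : FreeGroup.mk (M.word l) • K = J ∧ Adj (FreeGroup.mk (M.word l) • x) J := by
      rcases h3 with h3 | ⟨h3, h5⟩
      · exact h3
      · cases l with
        | nil =>
          obtain rfl : c = M.src e := h1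
          rw [hc, Option.some.injEq] at hK
          subst hK
          have h0 : M.word [] = [] := rfl
          rw [h0, mk_nil_smul, mk_nil_smul]
          exact ⟨rfl, hJ⟩
        | cons a l => exact absurd hK (hl e (by simp) K h3)
    obtain ⟨rfl, h5⟩ := h4
    cases hK' : st (M.tgt e) with
    | none => rw [hK, hK'] at hE; exact hE.elim
    | some K' =>
    rw [hK, hK'] at hE
    rw [word_concat, mk_append_smul]
    obtain ⟨hsame, hE⟩ := hE
    refine ⟨h2.trans (hsame.smul _), K', rfl, ?_⟩
    rw [mk_append_smul]
    rcases hE with ⟨rfl, h6⟩ | ⟨h6, h7, h8⟩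
    · rw [smul_inv_smul]
      exact .inl ⟨rfl, h6.smul _⟩
    · have h9 := h7.smul (FreeGroup.mk (M.word l))
      exact .inr ⟨h6, h9, ((separates_smul_iff _).2 h8).of_same_left
        (h9.symm.sameHalfspace_of_adj h5 hJ)⟩

theorem isProgressing_of_transition (hst : st M.start = none)
    (hM : ∀ e, Transition (fun t => FreeGroup.mk [t]) x T (st (M.src e)) (M.label e)
      (st (M.tgt e)))
    (hne : ∃ q, ∃ K ∈ visibleBy (fun t => FreeGroup.mk [t]) x T, st q = some K) :
    M.IsProgressing x := by
  obtain ⟨q₀, K₀, hK₀, hq₀⟩ := hne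
  refine ⟨{q | ∃ K ∈ visibleBy (fun t => FreeGroup.mk [t]) x T, st q = some K},
    -- The default `K₀` only gives a value at the vertices without a hyperplane, which lie outside
    -- the chosen set.
    fun q => (st q).getD K₀, ⟨q₀, K₀, hK₀, hq₀⟩, ?_, ?_, ?_, ?_⟩
  · rintro ⟨K, -, h⟩
    rw [hst] at h
    cases h
  · rintro c ⟨K, ⟨t, -, h1, h2⟩, h⟩
    simp only [h, Option.getD_some]
    exact ⟨t, h2, h1.isClosest⟩
  · intro l q hl hp _
    obtain ⟨K, h1, -, h2⟩ := separates_of_isPath hst hM hl hp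
    refine ⟨fun h => h2 (by rw [h]; exact .refl _ _), fun _ => ?_⟩
    simpa only [h1, Option.getD_some] using h2
  · rintro c ⟨J, ⟨t, -, hJ, -⟩, hc⟩ l q hp hl
    obtain ⟨h1, K, h2, h3⟩ := sameHalfspace_of_isPath hM hc hJ hp
      fun e he K hK h => hl e he ⟨K, hK, h⟩
    simp only [hc, h2, Option.getD_some]
    exact ⟨h1, fun _ => h3.imp And.left And.right⟩

end Automaton

/-! ### The theorem and its constants. -/

open CubeComplex in
theorem theorem4p10 :
    ∃ θ : ℕ → ℝ → ℝ,
      (∀ (n : ℕ) (ε₁ : ℝ), 0 < ε₁ → ε₁ < 1 → 0 < θ n ε₁ ∧ θ n ε₁ ≤ 1) ∧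
      ∀ (n : ℕ) (ε₁ : ℝ), 0 < ε₁ → ε₁ < 1 →
      ∀ (S : Type u) [Finite S] [Nonempty S] (X : CubeComplex.{v}) [CubicalAction (FreeGroup S) X],
        X.IsCAT0 → X.HasDim n →
        ∀ x : X.Cube 0, (∀ s : S × Bool, FreeGroup.mk [s] • x ≠ x) →
        (∀ H : X.Hyperplane, VisibleHyperplane (S := S) x H →
          ((backward (S := S) x H).ncard : ℝ) ≤ ε₁ * (Nat.card (S × Bool) : ℝ)) →
        ∃ M : Automaton (S × Bool),
          M.Deterministic ∧
          M.IsProgressing x ∧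
          Nat.card M.V ≤ (Nat.card (S × Bool) * n + 1) ^ n ∧
          M.LargeGrowth (θ n ε₁) ∧
          M.NoDeadEnds ∧
          ∀ w ∈ M.language, w ≠ [] → FreeGroup.mk w • x ≠ x := by
  refine ⟨fun n ε => (1 - ε) / (16 * (n + 1)), fun n ε h0 h1 => ⟨?_, ?_⟩, ?_⟩
  · have : 0 < 1 - ε := by linarith
    positivity
  · rw [div_le_one (by positivity)]
    have : (0 : ℝ) ≤ n := n.cast_nonneg
    linarith
  intro n ε hε0 hε1 S _ _ X _ hX hn x hmove hback
  set a : ℝ := (Nat.card (S × Bool) : ℝ) with ha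
  have ha0 : 0 < a := by
    rw [ha, Nat.cast_pos]
    exact Nat.card_pos
  -- Chosen so that `n * μ` discarded letters, at most `ε * a` crossing letters and `n * (μ / 4)`
  -- bad letters together stay below `a`. The growth constant is the proportion `μ / 4` of `a`.
  set μ : ℝ := (1 - ε) / (4 * (n + 1)) * a with hμ
  have hμ0 : 0 < μ := by
    have : 0 < 1 - ε := by linarith
    positivity
  have hθ : (1 - ε) / (16 * (n + 1)) * a = μ / 4 := by
    rw [hμ]
    field_simp
    norm_num
  have hμn : μ * (n + 1) = (1 - ε) * a / 4 := by
    rw [hμ]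
    field_simp
  let γ : S × Bool → FreeGroup S := fun t => FreeGroup.mk [t]
  let ι : S × Bool → S × Bool := fun t => (t.1, !t.2)
  have hιι : ∀ t, ι (ι t) = t := fun t => by simp [ι]
  have hιγ : ∀ t, γ (ι t) = (γ t)⁻¹ := fun t => by simp [ι, γ, FreeGroup.inv_mk, FreeGroup.invRev]
  obtain ⟨T, hTι, hTc, hTH⟩ := exists_alphabet (γ := γ) (x := x) hX hn ι hιι hμ0.le
  -- A letter moves `x`, so some hyperplane is adjacent to `x` and the dimension is positive.
  have hn0 : 0 < n := by
    obtain ⟨K, hK, -⟩ := hX.exists_adj_separates (hmove (Classical.arbitrary _)).symm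
    exact hX.length_le_of_pairwise_crosses hn (L := [K]) (by simp) (by simpa using hK)
  have hgood : ∀ H ∈ visibleBy γ x T, IsGood γ x T (μ / 4) n H := by
    refine fun H hH => isGood_of_mem_visibleBy hX hn hmove hTH (by positivity) ?_ hH
    rintro H ⟨t, -, h1, h2⟩
    have h3 := hback H ⟨t, h2, h1.isClosest⟩
    have h4 : ((crossing γ x T H).ncard : ℝ) ≤ (backward (S := S) x H).ncard :=
      Nat.cast_le.2 (Set.ncard_le_ncard (fun s hs => hs.2) (Set.toFinite _))
    have h5 : 0 < (1 - ε) * a := mul_pos (by linarith) ha0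
    rw [← ha]
    nlinarith
  have hvis : visibleBy γ x T ⊆ states γ x T (μ / 4) n := by
    intro H hH
    refine ⟨?_, 0, hn0, hH, hgood H hH⟩
    obtain ⟨t, -, h, -⟩ := hH
    exact h
  have hTcard : μ / 4 ≤ (T.ncard : ℝ) := by
    have h1 := Set.ncard_add_ncard_compl T
    have h2 : (T.ncard : ℝ) + Tᶜ.ncard = a := by rw [ha]; exact_mod_cast h1
    nlinarith
  obtain ⟨hfin, hcard⟩ := hX.ncard_states_le (γ := γ) (x := x) hn hn0 T (μ / 4)
  have : Finite (states γ x T (μ / 4) n) := hfin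
  obtain ⟨M, st, hst, hdet, hM, hM'⟩ := Automaton.exists_of_relation
    (W := Option (states γ x T (μ / 4) n)) (A := S × Bool) none
    fun p t q => Transition γ x T (p.map Subtype.val) t (q.map Subtype.val)
  have hst' : (fun q => (st q).map Subtype.val) M.start = (none : Option X.Hyperplane) := by
    simp [hst]
  have hlarge : ∀ q, M.LargeAt ((1 - ε) / (16 * (n + 1))) q := by
    intro q
    have h1 : μ / 4 ≤ ({t | ∃ w, Transition γ x T ((st q).map Subtype.val) t
        (Option.map (Subtype.val : states γ x T (μ / 4) n → _) w)}.ncard : ℝ) := by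
      cases hq : st q with
      | none =>
        refine hTcard.trans (Nat.cast_le.2 (Set.ncard_le_ncard (fun t ht => ?_) (Set.toFinite _)))
        obtain ⟨K, hK, h⟩ := exists_transition_none hX hιγ hTι hmove ht
        exact ⟨some ⟨K, hvis hK⟩, h⟩
      | some J =>
        refine (exists_transition_some hX hιγ hTι hvis J.2).trans
          (Nat.cast_le.2 (Set.ncard_le_ncard (fun t ht => ?_) (Set.toFinite _)))
        obtain ⟨K, hK, h⟩ := ht
        exact ⟨some ⟨K, hK⟩, h⟩
    rw [Automaton.LargeAt, ← ha, hθ]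
    refine h1.trans (Nat.cast_le.2 ?_)
    have := M.finite_E
    refine (Set.ncard_le_ncard (t := M.label '' {e | M.src e = q}) (fun t ht => ?_)
      (Set.toFinite _)).trans (Set.ncard_image_le (Set.toFinite _))
    exact hM' q t ht
  have hdead : ∀ q, ∃ e, M.src e = q := by
    intro q
    have h1 := hlarge q
    rw [Automaton.LargeAt, ← ha, hθ] at h1
    have h2 : 0 < {e | M.src e = q}.ncard := by
      have h3 : (0 : ℝ) < {e | M.src e = q}.ncard := by linarith
      exact_mod_cast h3
    obtain ⟨e, he⟩ := Set.nonempty_of_ncard_ne_zero h2.ne'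
    exact ⟨e, he⟩
  refine ⟨M, hdet, Automaton.isProgressing_of_transition (T := T)
    (st := fun q => (st q).map Subtype.val) hst' hM ?_, ?_,
    -- Every vertex, including the start, has enough outgoing edges, so the threshold length `1`
    -- suffices.
    ⟨1, one_pos, fun _ q _ _ => hlarge q⟩, fun _ q _ => hdead q, ?_⟩
  · have hTne : T.Nonempty := by
      refine Set.nonempty_of_ncard_ne_zero fun h => ?_
      rw [h] at hTcard
      norm_num at hTcard
      linarith
    obtain ⟨t, ht⟩ := hTne
    obtain ⟨K, hK, -⟩ := exists_transition_none hX hιγ hTι hmove ht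
    exact ⟨st.symm (some ⟨K, hvis hK⟩), K, hK, by simp⟩
  · rw [Nat.card_congr st, Finite.card_option, add_comm]
    exact hcard
  · rintro w ⟨l, q, hp, rfl⟩ hw h
    obtain ⟨K, -, -, hs⟩ := Automaton.separates_of_isPath (T := T)
      (st := fun q => (st q).map Subtype.val) hst' hM
      (fun h => hw (by rw [h]; rfl)) hp
    exact hs (by rw [h]; exact .refl _ _)
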